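/- A plane graph is a finite simple graph (not necessarily connected) drawn in the Euclidean plane: its vertices are distinct points, each edge is a simple polygonal arc joining its two ends and containing no other vertex, and two different edges have no point in common except possibly a common end. Its faces are the connected components of the complement of the drawing (the unbounded one included). The length of a face is the number of edges on its boundary, where an edge with that face on both sides is counted twice. Let $n\ge k\ge 4$ be integers. The maximum number $E_k(n)$ of edges of a plane graph on $n$ vertices in which every vertex lies on the boundary of some face of length at least $k$ is $$E_k(n)=\left\lfloor \frac{(2k+3)n}{k}-6\right\rfloor-\alpha ,$$ where $$\alpha=\begin{cases}0 & \text{if } n\equiv k-1 \pmod k,\\[2pt] \left\lfloor 2-\frac{6}{k}\right\rfloor & \text{if } n\equiv k-2 \pmod k,\\[2pt] \left\lfloor \frac{3\beta}{k}\right\rfloor & \text{if } n\equiv \beta \pmod k \text{ with } 0\le\beta\le k-3.\end{cases}$$ -/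

import Mathlib

/-- The Euclidean plane. -/
abbrev Plane : Type := EuclideanSpace ℝ (Fin 2)

/-- `S` is a (simple) polygonal arc from `a` to `b`: the union of straight segments
`[p 0, p 1], [p 1, p 2], …, [p r, p (r + 1)]` with `p 0 = a` and `p (r + 1) = b`, each of them
non-degenerate, where consecutive segments meet only in their common end point and
non-consecutive segments are disjoint. -/
def IsPolygonalArc (a b : Plane) (S : Set Plane) : Prop :=
  ∃ (r : ℕ) (p : ℕ → Plane),
    p 0 = a ∧ p (r + 1) = b ∧
    (∀ i, i ≤ r → p i ≠ p (i + 1)) ∧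
    (∀ i, i + 1 ≤ r →
      segment ℝ (p i) (p (i + 1)) ∩ segment ℝ (p (i + 1)) (p (i + 2)) = {p (i + 1)}) ∧
    (∀ i j, i + 2 ≤ j → j ≤ r →
      Disjoint (segment ℝ (p i) (p (i + 1))) (segment ℝ (p j) (p (j + 1)))) ∧
    S = ⋃ i ∈ Finset.range (r + 1), segment ℝ (p i) (p (i + 1))

/-- A (simple) plane graph with vertex set `V`: the vertices are distinct points of the plane,
every edge is a polygonal arc between its two ends, an edge contains no vertex besides its ends,
and two different edges have no point in common besides vertices. -/
structure PlaneGraph (V : Type*) where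
  /-- the underlying abstract simple graph -/
  graph : SimpleGraph V
  /-- the point representing a vertex -/
  pos : V → Plane
  /-- the arc representing an edge (values at non-edges are irrelevant) -/
  arc : Sym2 V → Set Plane
  pos_injective : Function.Injective pos
  isPolygonalArc : ∀ u v, graph.Adj u v → IsPolygonalArc (pos u) (pos v) (arc s(u, v))
  mem_of_pos_mem_arc : ∀ e ∈ graph.edgeSet, ∀ w, pos w ∈ arc e → w ∈ e
  arc_inter_arc_subset : ∀ e ∈ graph.edgeSet, ∀ e' ∈ graph.edgeSet, e ≠ e' →
    arc e ∩ arc e' ⊆ Set.range pos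

namespace PlaneGraph

variable {V : Type*} (G : PlaneGraph V)

/-- The set of points of the plane occupied by the vertices and edges. -/
def support : Set Plane :=
  Set.range G.pos ∪ ⋃ e ∈ G.graph.edgeSet, G.arc e

/-- The faces (regions): the connected components of the complement of the plane graph,
the unbounded one included. -/
def faces : Set (Set Plane) :=
  {F | ∃ x ∈ G.supportᶜ, F = connectedComponentIn G.supportᶜ x}

/-- The edges on the boundary of `F`. -/
def boundaryEdges (F : Set Plane) : Set (Sym2 V) :=
  {e | e ∈ G.graph.edgeSet ∧ G.arc e ⊆ frontier F}

/-- The edges that have the face `F` on both sides. -/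
def doubleEdges (F : Set Plane) : Set (Sym2 V) :=
  {e | e ∈ G.boundaryEdges F ∧ ∀ F' ∈ G.faces, e ∈ G.boundaryEdges F' → F' = F}

/-- The length of a face, i.e. the total length of its boundary walks: the number of edges on its
boundary, where an edge that has the face on both sides counts twice. A face of length `ℓ` is
an `ℓ`-gon. -/
noncomputable def faceLength (F : Set Plane) : ℕ :=
  (G.boundaryEdges F).ncard + (G.doubleEdges F).ncard

/-- Every vertex lies on the boundary of some face of length at least `k`. -/
def EveryVertexBoundsGon (k : ℕ) : Prop :=
  ∀ v : V, ∃ F ∈ G.faces, k ≤ G.faceLength F ∧ G.pos v ∈ frontier F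

/-- The number of edges. -/
noncomputable def numEdges : ℕ := G.graph.edgeSet.ncard

end PlaneGraph

/-- The correction term `α`, depending on the residue of `n` modulo `k` (for `4 ≤ k`). -/
noncomputable def alphaCorrection (k n : ℕ) : ℤ :=
  if n % k = k - 1 then 0
  else if n % k = k - 2 then ⌊(2 : ℝ) - 6 / (k : ℝ)⌋
  else ⌊(3 * ((n % k : ℕ) : ℝ)) / (k : ℝ)⌋

/-!
The number of edges is bounded by counting edge sides, as for plane triangulations, and the bound is
attained by triangulations from which some edges are deleted so as to create big faces.

**Upper bound.** Let `e` be the number of edges, `f` that of faces, `n'` that of non-isolated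
vertices, and let `t` faces have length at least `k`. The argument needs four facts.

* Every edge has two sides, so the lengths of the faces add up to at most `2 e`
  (`PlaneGraph.sum_faceLength_le`).
* If there are at least two edges, every face has length at least three
  (`PlaneGraph.three_le_faceLength`).
* A face has at most as many non-isolated vertices on its boundary as its length
  (`PlaneGraph.card_le_faceLength`).
* Euler's inequality `e + 2 ≤ f + n'` (`PlaneGraph.numEdges_add_two_le`).

Hence `e ≤ 3 n' - 6 + 3 t - L`, where `L` is the total length of the big faces. Since they cover
all vertices, `L ≥ n'`, and `L ≥ k t` by definition; the first estimate is used when `t ≤ n / k`,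
the second when `t > n / k` (`PlaneGraph.numEdges_le`).

The first three facts come from the local structure: near each of its points the drawing is a star of
finitely many radii (`LocalStar`), a face adherent to the centre contains a sector between two
consecutive radii (`LocalStar.exists_sector`), and being adherent to a face propagates along the
edges (`PlaneGraph.arc_subset_closure`). Euler's inequality is obtained without the Jordan curve
theorem: a real flow `z` on the edges has a winding number `∑ z e * θ e x`, with `θ e x` the angle
under which the edge `e` is seen from `x`. It is constant on faces because of the conservation law,
and it jumps by `2π z e` across `e`. So flows and constants together embed into the functions on the
set of faces, and the space of flows has dimension at least `e - n' + 1`.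

**Extremal graphs.** Take points of a parabola, all joined to an apex below it, and triangulate
their convex hull by a fan. Deleting consecutive edges at the apex merges triangles into a big face
with the apex on its boundary (a gap); replacing consecutive edges of the fan by one chord gives a big face
inside the hull (a block). All faces in question are star-shaped, and the lines spanned by the
vertices show that nothing else enters them (`exists_gap_face`, `exists_block_face`).
-/

/-! ### Rotations and sectors -/

/-- The identification of the Euclidean plane with the complex plane. -/
noncomputable def toC : Plane ≃ₗᵢ[ℝ] ℂ := Complex.orthonormalBasisOneI.repr.symm

/-- Rotation of the plane by the angle `θ` about the origin. -/
noncomputable def rot (θ : ℝ) (u : Plane) : Plane :=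
  toC.symm (Complex.exp (θ * Complex.I) * toC u)

lemma rot_zero_left (u : Plane) : rot 0 u = u := by simp [rot]

lemma norm_rot (θ : ℝ) (u : Plane) : ‖rot θ u‖ = ‖u‖ := by
  simp [rot, Complex.norm_exp_ofReal_mul_I]

lemma rot_smul (θ c : ℝ) (u : Plane) : rot θ (c • u) = c • rot θ u := by
  rw [rot, rot, map_smul toC, mul_smul_comm, map_smul]

lemma rot_rot (s t : ℝ) (u : Plane) : rot s (rot t u) = rot (s + t) u := by
  simp [rot, add_mul, Complex.exp_add, mul_assoc]

lemma rot_sub_two_pi (t : ℝ) (u : Plane) : rot (t - 2 * Real.pi) u = rot t u := by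
  have : Complex.exp (((t - 2 * Real.pi : ℝ) : ℂ) * Complex.I) = Complex.exp (t * Complex.I) := by
    rw [show ((t - 2 * Real.pi : ℝ) : ℂ) * Complex.I
      = t * Complex.I - 2 * Real.pi * Complex.I by push_cast; ring]
    exact Complex.exp_periodic.sub_eq _
  simp only [rot, this]

lemma continuous_rot_left (u : Plane) : Continuous fun t : ℝ => rot t u := by
  unfold rot
  exact toC.symm.continuous.comp (by fun_prop)

lemma rot_ne_zero {u : Plane} (hu : u ≠ 0) (t : ℝ) : rot t u ≠ 0 := by
  rw [← norm_ne_zero_iff, norm_rot]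
  exact norm_ne_zero_iff.2 hu

lemma exists_eq_smul_rot {u w : Plane} (hu : u ≠ 0) (hw : w ≠ 0) (lo : ℝ) :
    ∃ ρ : ℝ, 0 < ρ ∧ ∃ t ∈ Set.Ico lo (lo + 2 * Real.pi), w = ρ • rot t u := by
  have hu' : toC u ≠ 0 := by simpa using hu
  have hw' : toC w ≠ 0 := by simpa using hw
  set z := toC w / toC u with hz
  have hz0 : z ≠ 0 := div_ne_zero hw' hu'
  refine ⟨‖z‖, norm_pos_iff.2 hz0, toIcoMod Real.two_pi_pos lo z.arg,
    toIcoMod_mem_Ico _ _ _, ?_⟩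
  apply toC.injective
  have h1 : Complex.exp ((toIcoMod Real.two_pi_pos lo z.arg : ℝ) * Complex.I)
      = Complex.exp (z.arg * Complex.I) := by
    rw [toIcoMod, Complex.exp_eq_exp_iff_exists_int]
    refine ⟨-toIcoDiv Real.two_pi_pos lo z.arg, ?_⟩
    push_cast [zsmul_eq_mul]
    ring
  rw [map_smul, rot, LinearIsometryEquiv.apply_symm_apply, h1, Complex.real_smul, ← mul_assoc,
    Complex.norm_mul_exp_arg_mul_I, hz, div_mul_cancel₀ _ hu']

lemma exists_int_of_smul_rot_eq {u : Plane} (hu : u ≠ 0) {a b s t : ℝ} (ha : 0 < a) (hb : 0 < b)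
    (h : a • rot s u = b • rot t u) : ∃ n : ℤ, s = t + n * (2 * Real.pi) := by
  have hab : a = b := by
    have := congrArg norm h
    rw [norm_smul, norm_smul, norm_rot, norm_rot, Real.norm_of_nonneg ha.le,
      Real.norm_of_nonneg hb.le] at this
    exact mul_right_cancel₀ (norm_ne_zero_iff.2 hu) this
  subst hab
  have h2 := smul_right_injective Plane ha.ne' h
  have h3 := mul_right_cancel₀ (by simpa using hu) (toC.symm.injective h2)
  obtain ⟨n, hn⟩ := Complex.exp_eq_exp_iff_exists_int.1 h3
  refine ⟨n, ?_⟩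
  have h4 : ((s : ℝ) : ℂ) = ((t + n * (2 * Real.pi) : ℝ) : ℂ) := by
    apply mul_right_cancel₀ Complex.I_ne_zero
    rw [hn]; push_cast; ring
  exact_mod_cast h4

/-- Inside the disc of radius `r` about `x`, the set `S` consists of `x` and of one radius in
each of the pairwise different directions `w i`. -/
structure LocalStar {ι : Type*} (S : Set Plane) (x : Plane) (w : ι → Plane) (r : ℝ) : Prop where
  pos : 0 < r
  mem : x ∈ S
  ne_zero : ∀ i, w i ≠ 0
  ray_ne : ∀ i j, i ≠ j → ∀ s : ℝ, 0 < s → ∀ t : ℝ, 0 < t → s • w i ≠ t • w j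
  mem_iff : ∀ u, ‖u‖ < r → u ≠ 0 → (x + u ∈ S ↔ ∃ i, ∃ t : ℝ, 0 < t ∧ u = t • w i)

/-- Rotating a point of the disc off `S` in both directions until a radius is met sweeps out an
open sector. It contains all points just before the radius `i` met counterclockwise and all points
just after the radius `j` met clockwise; these radii differ unless there is only one. -/
lemma LocalStar.exists_sector {ι : Type*} [Finite ι] [Nonempty ι] {S : Set Plane} {x : Plane}
    {w : ι → Plane} {r : ℝ} (h : LocalStar S x w r) {q : Plane} (hq : ‖q‖ < r) (hqS : x + q ∉ S) :
    ∃ i j, (i = j → Subsingleton ι) ∧ ∃ K : Set Plane, IsPreconnected K ∧ K ⊆ Sᶜ ∧ x + q ∈ K ∧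
      ∃ ε₀ : ℝ, 0 < ε₀ ∧ ∀ ε, 0 < ε → ε < ε₀ →
        (∀ τ : ℝ, 0 < τ → ‖τ • w i‖ < r → x + rot (-ε) (τ • w i) ∈ K) ∧
        (∀ τ : ℝ, 0 < τ → ‖τ • w j‖ < r → x + rot ε (τ • w j) ∈ K) := by
  have hq0 : q ≠ 0 := by
    rintro rfl
    exact hqS (by simpa using h.mem)
  choose ρ hρ a ha hw using fun i => exists_eq_smul_rot hq0 (h.ne_zero i) 0
  simp only [zero_add] at ha
  have ha0 : ∀ i, 0 < a i := by
    intro i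
    refine lt_of_le_of_ne (ha i).1 fun h0 => hqS ?_
    rw [h.mem_iff q hq hq0]
    refine ⟨i, (ρ i)⁻¹, inv_pos.2 (hρ i), ?_⟩
    rw [hw i, ← h0, rot_zero_left, smul_smul, inv_mul_cancel₀ (hρ i).ne', one_smul]
  obtain ⟨i, hi⟩ := Finite.exists_min a
  obtain ⟨j, hj⟩ := Finite.exists_max a
  have hnq : 0 < ‖q‖ := norm_pos_iff.2 hq0
  refine ⟨i, j, ?_, ?_⟩
  · rintro rfl
    refine ⟨fun k l => ?_⟩
    by_contra hkl
    have hk : a k = a l := by linarith [hi k, hj k, hi l, hj l]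
    refine h.ray_ne k l hkl (ρ l) (hρ l) (ρ k) (hρ k) ?_
    rw [hw k, hw l, hk, smul_smul, smul_smul, mul_comm]
  · have hK : ∀ s t : ℝ, s ∈ Set.Ioo 0 (r / ‖q‖) → t ∈ Set.Ioo (a j - 2 * Real.pi) (a i) →
        x + s • rot t q ∈ (fun p : ℝ × ℝ => x + p.1 • rot p.2 q) ''
          (Set.Ioo 0 (r / ‖q‖) ×ˢ Set.Ioo (a j - 2 * Real.pi) (a i)) :=
      fun s t hs ht => ⟨(s, t), ⟨hs, ht⟩, rfl⟩
    refine ⟨(fun p : ℝ × ℝ => x + p.1 • rot p.2 q) ''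
      (Set.Ioo 0 (r / ‖q‖) ×ˢ Set.Ioo (a j - 2 * Real.pi) (a i)), ?_, ?_, ?_,
      a i - (a j - 2 * Real.pi), ?_, ?_⟩
    · refine (isPreconnected_Ioo.prod isPreconnected_Ioo).image _ (Continuous.continuousOn ?_)
      have : Continuous fun p : ℝ × ℝ => rot p.2 q :=
        (continuous_rot_left q).comp continuous_snd
      exact continuous_const.add (continuous_fst.smul this)
    · rintro _ ⟨⟨s, t⟩, ⟨hs, ht⟩, rfl⟩ hS
      simp only [Set.mem_Ioo] at hs ht
      have hn : ‖s • rot t q‖ < r := by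
        rw [norm_smul, norm_rot, Real.norm_of_nonneg hs.1.le]
        exact (lt_div_iff₀ hnq).1 hs.2
      obtain ⟨k, τ, hτ, hk⟩ :=
        (h.mem_iff _ hn (smul_ne_zero hs.1.ne' (rot_ne_zero hq0 t))).1 hS
      rw [hw k, smul_smul] at hk
      obtain ⟨n, hn⟩ := exists_int_of_smul_rot_eq hq0 hs.1 (mul_pos hτ (hρ k)) hk
      have h1 : (n : ℝ) * (2 * Real.pi) < 0 := by linarith [hi k]
      have h2 : -(2 * Real.pi) < (n : ℝ) * (2 * Real.pi) := by linarith [hj k]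
      have h3 : (n : ℝ) < 0 := by
        by_contra hc
        have := mul_nonneg (not_lt.1 hc) Real.two_pi_pos.le
        linarith
      have h4 : (-1 : ℝ) < n := by
        by_contra hc
        have := mul_le_mul_of_nonneg_right (not_lt.1 hc) Real.two_pi_pos.le
        linarith
      have h5 : n < 0 := by exact_mod_cast h3
      have h6 : -1 < n := by exact_mod_cast h4
      omega
    · have := hK 1 0 ⟨one_pos, (one_lt_div hnq).2 hq⟩ ⟨by linarith [(ha j).2], ha0 i⟩
      rwa [rot_zero_left, one_smul] at this
    · linarith [(ha j).2, ha0 i]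
    · intro ε hε hε'
      have hs : ∀ k, ∀ τ : ℝ, 0 < τ → ‖τ • w k‖ < r → τ * ρ k ∈ Set.Ioo 0 (r / ‖q‖) := by
        intro k τ hτ hn
        refine ⟨mul_pos hτ (hρ k), ?_⟩
        rw [hw k, smul_smul, norm_smul, norm_rot,
          Real.norm_of_nonneg (mul_pos hτ (hρ k)).le] at hn
        exact (lt_div_iff₀ hnq).2 hn
      have hrot : ∀ k τ ε, rot ε (τ • w k) = (τ * ρ k) • rot (ε + a k) q := by
        intro k τ ε
        rw [hw k, rot_smul, rot_smul, rot_rot, smul_smul]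
      constructor
      · intro τ hτ hn
        rw [hrot]
        exact hK _ _ (hs i τ hτ hn) ⟨by linarith, by linarith⟩
      · intro τ hτ hn
        rw [hrot, ← rot_sub_two_pi]
        exact hK _ _ (hs j τ hτ hn) ⟨by linarith, by linarith⟩

/-! ### Local structure of polygonal arcs -/

lemma isClosed_segment_plane (a b : Plane) : IsClosed (segment ℝ a b) := by
  rw [segment_eq_image_lineMap]
  exact (isCompact_Icc.image AffineMap.lineMap_continuous).isClosed

/-- Near its end `a`, the segment from `a` to `b` is a ray. -/
lemma mem_segment_iff_of_norm_lt {a b u : Plane} (hu : ‖u‖ < ‖b - a‖) (h0 : u ≠ 0) :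
    a + u ∈ segment ℝ a b ↔ ∃ t : ℝ, 0 < t ∧ u = t • (b - a) := by
  rw [segment_eq_image']
  constructor
  · rintro ⟨t, ht, h⟩
    have h : u = t • (b - a) := (add_left_cancel h).symm
    refine ⟨t, lt_of_le_of_ne ht.1 ?_, h⟩
    rintro rfl
    exact h0 (by simpa using h)
  · rintro ⟨t, ht, rfl⟩
    refine ⟨t, ⟨ht.le, ?_⟩, rfl⟩
    rw [norm_smul, Real.norm_of_nonneg ht.le] at hu
    by_contra hc
    have := mul_le_mul_of_nonneg_right (not_le.1 hc).le (norm_nonneg (b - a))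
    linarith

lemma segment_union_of_mem {a b x : Plane} (hx : x ∈ segment ℝ a b) :
    segment ℝ a b = segment ℝ x a ∪ segment ℝ x b := by
  obtain ⟨s, hs, rfl⟩ := (segment_eq_image_lineMap ℝ a b ▸ hx :)
  have h (t : ℝ) (c : Plane) (hc : AffineMap.lineMap a b t = c) :
      segment ℝ (AffineMap.lineMap a b s) c = AffineMap.lineMap a b '' segment ℝ s t := by
    rw [image_segment, hc]
  rw [h 0 a (by simp), h 1 b (by simp), ← Set.image_union, segment_symm ℝ s 0,
    segment_eq_Icc hs.1, segment_eq_Icc hs.2, Set.Icc_union_Icc_eq_Icc hs.1 hs.2,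
    segment_eq_image_lineMap]

lemma segment_inter_of_mem {a b x : Plane} (hx : x ∈ segment ℝ a b) :
    segment ℝ x a ∩ segment ℝ x b = {x} := by
  rcases eq_or_ne a b with rfl | hab
  · rw [segment_same] at hx
    rw [Set.mem_singleton_iff.1 hx, segment_same, Set.inter_self]
  obtain ⟨s, hs, rfl⟩ := (segment_eq_image_lineMap ℝ a b ▸ hx :)
  have h (t : ℝ) (c : Plane) (hc : AffineMap.lineMap a b t = c) :
      segment ℝ (AffineMap.lineMap a b s) c = AffineMap.lineMap a b '' segment ℝ s t := by
    rw [image_segment, hc]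
  rw [h 0 a (by simp), h 1 b (by simp),
    ← Set.image_inter (AffineMap.lineMap_injective ℝ hab), segment_symm ℝ s 0,
    segment_eq_Icc hs.1, segment_eq_Icc hs.2, Set.Icc_inter_Icc_eq_singleton hs.1 hs.2,
    Set.image_singleton]

lemma convex_segment_diff_left (a b : Plane) : Convex ℝ (segment ℝ a b \ {a}) := by
  rcases eq_or_ne a b with rfl | hab
  · simpa [segment_same] using convex_empty
  have : segment ℝ a b \ {a} = AffineMap.lineMap a b '' Set.Ioc (0 : ℝ) 1 := by
    rw [segment_eq_image_lineMap, ← Set.Icc_sdiff_left,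
      Set.image_sdiff (AffineMap.lineMap_injective ℝ hab)]
    simp
  rw [this]
  exact (convex_Ioc 0 1).affine_image _

/-- A finite family of closed sets: near `x` only the sets containing `x` matter. -/
lemma exists_ball_inter_biUnion {ι : Type*} (s : Finset ι) (A : ι → Set Plane)
    (hA : ∀ i ∈ s, IsClosed (A i)) (x : Plane) :
    ∃ ρ : ℝ, 0 < ρ ∧ ∀ u, ‖u‖ < ρ → ∀ i ∈ s, x + u ∈ A i → x ∈ A i := by
  classical
  have h : ∀ᶠ y in nhds x, ∀ i ∈ s, y ∈ A i → x ∈ A i := by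
    rw [Filter.eventually_all_finset]
    intro i hi
    by_cases hx : x ∈ A i
    · exact Filter.Eventually.of_forall fun _ _ => hx
    · filter_upwards [(hA i hi).isOpen_compl.mem_nhds hx] with y hy h
      exact absurd h hy
  obtain ⟨ρ, hρ, h⟩ := Metric.eventually_nhds_iff.1 h
  refine ⟨ρ, hρ, fun u hu => h ?_⟩
  simpa [dist_eq_norm] using hu

lemma IsPolygonalArc.isClosed {a b : Plane} {S : Set Plane} (h : IsPolygonalArc a b S) :
    IsClosed S := by
  obtain ⟨r, p, -, -, -, -, -, rfl⟩ := h
  exact (Finset.range (r + 1)).finite_toSet.isClosed_biUnion fun i _ => isClosed_segment_plane _ _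

lemma IsPolygonalArc.left_mem {a b : Plane} {S : Set Plane} (h : IsPolygonalArc a b S) :
    a ∈ S := by
  obtain ⟨r, p, rfl, -, -, -, -, rfl⟩ := h
  exact Set.mem_biUnion (x := 0) (by simp) (left_mem_segment ℝ _ _)

/-- Near its initial point a polygonal arc is a ray. -/
lemma IsPolygonalArc.exists_left_ray {a b : Plane} {S : Set Plane} (h : IsPolygonalArc a b S) :
    ∃ w : Plane, w ≠ 0 ∧ ∃ ρ : ℝ, 0 < ρ ∧
      ∀ u, ‖u‖ < ρ → u ≠ 0 → (a + u ∈ S ↔ ∃ t : ℝ, 0 < t ∧ u = t • w) := by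
  obtain ⟨r, p, rfl, -, hne, hcons, hdis, rfl⟩ := h
  have h01 := hne 0 (Nat.zero_le _)
  obtain ⟨ρ, hρ, hloc⟩ := exists_ball_inter_biUnion (Finset.range (r + 1))
    (fun i => segment ℝ (p i) (p (i + 1))) (fun i _ => isClosed_segment_plane _ _) (p 0)
  refine ⟨p 1 - p 0, sub_ne_zero.2 h01.symm, min ρ ‖p 1 - p 0‖,
    lt_min hρ (norm_pos_iff.2 (sub_ne_zero.2 h01.symm)), fun u hu hu0 => ?_⟩
  rw [← mem_segment_iff_of_norm_lt (hu.trans_le (min_le_right _ _)) hu0]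
  constructor
  · intro hm
    simp only [Set.mem_iUnion] at hm
    obtain ⟨i, hi, hm⟩ := hm
    have hx := hloc u (hu.trans_le (min_le_left _ _)) i hi hm
    rw [Finset.mem_range] at hi
    rcases i with _ | _ | i
    · exact hm
    · have : p 0 ∈ ({p 1} : Set Plane) := by
        rw [← hcons 0 (by omega)]
        exact ⟨left_mem_segment ℝ _ _, hx⟩
      exact absurd this h01
    · exact absurd hx (Set.disjoint_left.1 (hdis 0 (i + 2) (by omega) (by omega))
        (left_mem_segment ℝ _ _))
  · intro hm
    exact Set.mem_biUnion (x := 0) (by simp) hm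

/-- Near an interior point a polygonal arc consists of two segments emanating from that point. -/
lemma IsPolygonalArc.exists_two_segments {a b x : Plane} {S : Set Plane}
    (h : IsPolygonalArc a b S) (hx : x ∈ S) (hxa : x ≠ a) (hxb : x ≠ b) :
    ∃ y z : Plane, y ≠ x ∧ z ≠ x ∧ segment ℝ x y ∩ segment ℝ x z = {x} ∧ ∃ ρ : ℝ, 0 < ρ ∧
      ∀ u, ‖u‖ < ρ → (x + u ∈ S ↔ x + u ∈ segment ℝ x y ∪ segment ℝ x z) := by
  obtain ⟨r, p, rfl, rfl, hne, hcons, hdis, rfl⟩ := h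
  obtain ⟨ρ, hρ, hloc⟩ := exists_ball_inter_biUnion (Finset.range (r + 1))
    (fun i => segment ℝ (p i) (p (i + 1))) (fun i _ => isClosed_segment_plane _ _) x
  -- two segments can share `x` only if they are consecutive and `x` is their common end
  have key : ∀ i j, i < j → j ≤ r → x ∈ segment ℝ (p i) (p (i + 1)) →
      x ∈ segment ℝ (p j) (p (j + 1)) → j = i + 1 ∧ x = p (i + 1) := by
    intro i j hij hj hi' hj'
    have h1 : j = i + 1 := by
      by_contra hc
      exact Set.disjoint_left.1 (hdis i j (by omega) hj) hi' hj'
    subst h1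
    refine ⟨rfl, ?_⟩
    have : x ∈ ({p (i + 1)} : Set Plane) := by
      rw [← hcons i (by omega)]
      exact ⟨hi', hj'⟩
    exact this
  by_cases hv : ∃ i, i + 1 ≤ r ∧ x = p (i + 1)
  · obtain ⟨i, hi, rfl⟩ := hv
    refine ⟨p i, p (i + 2), hne i (by omega), (hne (i + 1) hi).symm, ?_, ρ, hρ, fun u hu => ?_⟩
    · rw [segment_symm, hcons i hi]
    · rw [segment_symm ℝ (p (i + 1)) (p i)]
      constructor
      · intro hm
        simp only [Set.mem_iUnion] at hm
        obtain ⟨j, hj, hm⟩ := hm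
        have hxj := hloc u hu j hj hm
        rw [Finset.mem_range] at hj
        rcases lt_trichotomy j i with hji | rfl | hji
        · obtain ⟨rfl, h2⟩ := key j i hji (by omega) hxj (right_mem_segment ℝ _ _)
          exact absurd h2.symm (hne (j + 1) (by omega))
        · exact Or.inl hm
        · obtain ⟨rfl, -⟩ := key i j hji (by omega) (right_mem_segment ℝ _ _) hxj
          exact Or.inr hm
      · rintro (hm | hm)
        · exact Set.mem_biUnion (x := i) (by simp; omega) hm
        · exact Set.mem_biUnion (x := i + 1) (by simp; omega) hm
  · simp only [Set.mem_iUnion] at hx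
    obtain ⟨i, hi, hx⟩ := hx
    rw [Finset.mem_range] at hi
    push Not at hv
    have h1 : x ≠ p i := by
      rcases i with _ | i
      · exact hxa
      · exact hv i (by omega)
    have h2 : x ≠ p (i + 1) := by
      rcases (by omega : i = r ∨ i + 1 ≤ r) with rfl | h
      · exact hxb
      · exact hv i h
    refine ⟨p i, p (i + 1), h1.symm, h2.symm, segment_inter_of_mem hx, ρ, hρ, fun u hu => ?_⟩
    rw [← segment_union_of_mem hx]
    constructor
    · intro hm
      simp only [Set.mem_iUnion] at hm
      obtain ⟨j, hj, hm⟩ := hm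
      have hxj := hloc u hu j hj hm
      rw [Finset.mem_range] at hj
      rcases lt_trichotomy j i with hji | rfl | hji
      · obtain ⟨rfl, h3⟩ := key j i hji (by omega) hxj hx
        exact absurd h3 h1
      · exact hm
      · obtain ⟨rfl, h3⟩ := key i j hji (by omega) hx hxj
        exact absurd h3 h2
    · intro hm
      exact Set.mem_biUnion (x := i) (by simp; omega) hm

/-- A polygonal arc without its ends is connected. -/
lemma IsPolygonalArc.isPreconnected_diff {a b : Plane} {S : Set Plane}
    (h : IsPolygonalArc a b S) : IsPreconnected (S \ {a, b}) := by
  obtain ⟨r, p, rfl, rfl, hne, hcons, hdis, rfl⟩ := h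
  have hfirst : ∀ i ≤ r, p 0 ∈ segment ℝ (p i) (p (i + 1)) → i = 0 := by
    intro i hi h0
    rcases i with _ | _ | i
    · rfl
    · have : p 0 ∈ ({p 1} : Set Plane) := by
        rw [← hcons 0 (by omega)]
        exact ⟨left_mem_segment ℝ _ _, h0⟩
      exact absurd this (hne 0 (by omega))
    · exact absurd h0 (Set.disjoint_left.1 (hdis 0 (i + 2) (by omega) (by omega))
        (left_mem_segment ℝ _ _))
  have hlast : ∀ i ≤ r, p (r + 1) ∈ segment ℝ (p i) (p (i + 1)) → i = r := by
    intro i hi h0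
    by_contra hir
    rcases (by omega : i + 1 = r ∨ i + 2 ≤ r) with rfl | h2
    · have : p (i + 1 + 1) ∈ ({p (i + 1)} : Set Plane) := by
        rw [← hcons i (by omega)]
        exact ⟨h0, right_mem_segment ℝ _ _⟩
      exact absurd (Set.mem_singleton_iff.1 this).symm (hne (i + 1) (by omega))
    · exact Set.disjoint_left.1 (hdis i r h2 le_rfl) h0 (right_mem_segment ℝ _ _)
  have heq : (⋃ i ∈ Finset.range (r + 1), segment ℝ (p i) (p (i + 1))) \ {p 0, p (r + 1)}
      = ⋃ i ∈ Set.Iic r, segment ℝ (p i) (p (i + 1)) \ {p 0, p (r + 1)} := by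
    ext x
    simp only [Set.mem_sdiff, Set.mem_iUnion, Finset.mem_range, Set.mem_Iic, exists_prop,
      Nat.lt_succ_iff]
    grind
  rw [heq]
  refine IsPreconnected.biUnion_of_chain Set.ordConnected_Iic ?_ ?_
  · intro i hi
    have hi : i ≤ r := hi
    have : segment ℝ (p i) (p (i + 1)) \ {p 0, p (r + 1)}
        = (segment ℝ (p i) (p (i + 1)) \ {p 0}) ∩ (segment ℝ (p i) (p (i + 1)) \ {p (r + 1)}) := by
      ext x
      simp only [Set.mem_sdiff, Set.mem_insert_iff, Set.mem_singleton_iff, Set.mem_inter_iff]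
      tauto
    rw [this]
    refine (Convex.inter ?_ ?_).isPreconnected
    · by_cases h0 : p 0 ∈ segment ℝ (p i) (p (i + 1))
      · rw [hfirst i hi h0]
        exact convex_segment_diff_left _ _
      · rw [Set.sdiff_singleton_eq_self h0]
        exact convex_segment _ _
    · by_cases h0 : p (r + 1) ∈ segment ℝ (p i) (p (i + 1))
      · rw [hlast i hi h0, segment_symm]
        exact convex_segment_diff_left _ _
      · rw [Set.sdiff_singleton_eq_self h0]
        exact convex_segment _ _
  · intro i hi hi'
    have hi' : i + 1 ≤ r := hi'
    refine ⟨p (i + 1), ⟨right_mem_segment ℝ _ _, ?_⟩, left_mem_segment ℝ _ _, ?_⟩ <;>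
    · rintro (h0 | h0)
      · have := hfirst (i + 1) hi' (h0 ▸ left_mem_segment ℝ _ _)
        omega
      · have h0 : p (i + 1) = p (r + 1) := h0
        have := hlast i (by omega) (h0 ▸ right_mem_segment ℝ _ _)
        omega

/-! ### Faces and their local structure -/

lemma tendsto_add_rot_mul (x u : Plane) (c : ℝ) :
    Filter.Tendsto (fun ε : ℝ => x + rot (c * ε) u) (nhdsWithin 0 (Set.Ioi 0)) (nhds (x + u)) := by
  have : Continuous fun ε : ℝ => x + rot (c * ε) u :=
    continuous_const.add ((continuous_rot_left u).comp (continuous_const.mul continuous_id))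
  have h := this.tendsto 0
  rw [mul_zero, rot_zero_left] at h
  exact h.mono_left nhdsWithin_le_nhds

namespace PlaneGraph

variable {V : Type*} {G : PlaneGraph V}

lemma arc_isPolygonalArc {e : Sym2 V} (he : e ∈ G.graph.edgeSet) {u v : V} (h : e = s(u, v)) :
    IsPolygonalArc (G.pos u) (G.pos v) (G.arc e) := by
  subst h
  exact G.isPolygonalArc u v he

lemma isClosed_arc {e : Sym2 V} (he : e ∈ G.graph.edgeSet) : IsClosed (G.arc e) := by
  induction e using Sym2.ind with
  | _ u v => exact (arc_isPolygonalArc he rfl).isClosed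

lemma pos_mem_arc {e : Sym2 V} (he : e ∈ G.graph.edgeSet) {v : V} (hv : v ∈ e) :
    G.pos v ∈ G.arc e := by
  obtain ⟨u, rfl⟩ := Sym2.mem_iff_exists.1 hv
  exact (arc_isPolygonalArc he rfl).left_mem

lemma arc_subset_support {e : Sym2 V} (he : e ∈ G.graph.edgeSet) : G.arc e ⊆ G.support :=
  fun _ hx => Or.inr (Set.mem_biUnion he hx)

lemma pos_mem_support (v : V) : G.pos v ∈ G.support := Or.inl ⟨v, rfl⟩

lemma isClosed_support [Finite V] : IsClosed G.support :=
  (Set.finite_range _).isClosed.union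
    ((Set.toFinite _).isClosed_biUnion fun _ he => isClosed_arc he)

section Faces

variable {F F' : Set Plane}

lemma isOpen_of_mem_faces [Finite V] (hF : F ∈ G.faces) : IsOpen F := by
  obtain ⟨x, -, rfl⟩ := hF
  exact isClosed_support.isOpen_compl.connectedComponentIn

lemma isPreconnected_of_mem_faces (hF : F ∈ G.faces) : IsPreconnected F := by
  obtain ⟨x, -, rfl⟩ := hF
  exact isPreconnected_connectedComponentIn

lemma nonempty_of_mem_faces (hF : F ∈ G.faces) : F.Nonempty := by
  obtain ⟨x, hx, rfl⟩ := hF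
  exact ⟨x, mem_connectedComponentIn hx⟩

lemma face_subset_compl (hF : F ∈ G.faces) : F ⊆ G.supportᶜ := by
  obtain ⟨x, -, rfl⟩ := hF
  exact connectedComponentIn_subset _ _

lemma subset_face (hF : F ∈ G.faces) {K : Set Plane} (hK : IsPreconnected K)
    (hKS : K ⊆ G.supportᶜ) (h : (K ∩ F).Nonempty) : K ⊆ F := by
  obtain ⟨x, -, rfl⟩ := hF
  obtain ⟨y, hyK, hyF⟩ := h
  rw [connectedComponentIn_eq hyF]
  exact hK.subset_connectedComponentIn hyK hKS

lemma face_eq_of_mem (hF : F ∈ G.faces) (hF' : F' ∈ G.faces) {x : Plane} (hx : x ∈ F)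
    (hx' : x ∈ F') : F = F' :=
  (subset_face hF' (isPreconnected_of_mem_faces hF) (face_subset_compl hF) ⟨x, hx, hx'⟩).antisymm
    (subset_face hF (isPreconnected_of_mem_faces hF') (face_subset_compl hF') ⟨x, hx', hx⟩)

lemma exists_face_mem {x : Plane} (hx : x ∉ G.support) : ∃ F ∈ G.faces, x ∈ F :=
  ⟨_, ⟨x, hx, rfl⟩, mem_connectedComponentIn hx⟩

lemma frontier_face [Finite V] (hF : F ∈ G.faces) : frontier F = closure F ∩ G.support := by
  rw [frontier, (isOpen_of_mem_faces hF).interior_eq]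
  ext x
  refine and_congr_right fun hx => ⟨fun hxF => ?_, fun hxS hxF => face_subset_compl hF hxF hxS⟩
  by_contra hxS
  obtain ⟨F', hF', hxF'⟩ := exists_face_mem hxS
  obtain ⟨y, hy, hy'⟩ := mem_closure_iff.1 hx F' (isOpen_of_mem_faces hF') hxF'
  exact hxF (face_eq_of_mem hF hF' hy' hy ▸ hxF')

lemma mem_boundaryEdges_iff [Finite V] (hF : F ∈ G.faces) {e : Sym2 V} :
    e ∈ G.boundaryEdges F ↔ e ∈ G.graph.edgeSet ∧ G.arc e ⊆ closure F := by
  refine and_congr_right fun he => ?_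
  rw [frontier_face hF, Set.subset_inter_iff]
  exact and_iff_left (arc_subset_support he)

/-- The set `F` contains all points just clockwise of the radius `w` of the disc about `x`. -/
def TouchesRay (F : Set Plane) (x w : Plane) (r : ℝ) : Prop :=
  ∃ ε₀ : ℝ, 0 < ε₀ ∧ ∀ ε, 0 < ε → ε < ε₀ → ∀ τ : ℝ, 0 < τ → ‖τ • w‖ < r →
    x + rot (-ε) (τ • w) ∈ F

lemma exists_pos_norm_smul_lt (w : Plane) {r : ℝ} (hr : 0 < r) : ∃ τ : ℝ, 0 < τ ∧ ‖τ • w‖ < r := by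
  refine ⟨r / (‖w‖ + 1), by positivity, ?_⟩
  rw [norm_smul, Real.norm_of_nonneg (by positivity), div_mul_eq_mul_div,
    div_lt_iff₀ (by positivity)]
  nlinarith [norm_nonneg w]

lemma TouchesRay.face_eq (hF : F ∈ G.faces) (hF' : F' ∈ G.faces) {x w : Plane} {r : ℝ} (hr : 0 < r)
    (h : TouchesRay F x w r) (h' : TouchesRay F' x w r) : F = F' := by
  obtain ⟨ε, hε, h⟩ := h
  obtain ⟨ε', hε', h'⟩ := h'
  obtain ⟨τ, hτ, hτr⟩ := exists_pos_norm_smul_lt w hr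
  have h1 : 0 < min ε ε' / 2 := half_pos (lt_min hε hε')
  have h2 : min ε ε' / 2 < min ε ε' := half_lt_self (lt_min hε hε')
  exact face_eq_of_mem hF hF' (h _ h1 (h2.trans_le (min_le_left _ _)) τ hτ hτr)
    (h' _ h1 (h2.trans_le (min_le_right _ _)) τ hτ hτr)

/-- A face adherent to the centre of a local star contains the points just clockwise of some radius
`i`, and both this radius and a radius `j` belong to its closure, where `j ≠ i` unless there is
only one radius. -/
lemma exists_rays_of_mem_closure [Finite V] (hF : F ∈ G.faces) {ι : Type*} [Finite ι] [Nonempty ι]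
    {x : Plane} {w : ι → Plane} {r : ℝ} (h : LocalStar G.support x w r) (hx : x ∈ closure F) :
    ∃ i j, (i = j → Subsingleton ι) ∧ TouchesRay F x (w i) r ∧
      (∀ τ : ℝ, 0 < τ → ‖τ • w i‖ < r → x + τ • w i ∈ closure F) ∧
      (∀ τ : ℝ, 0 < τ → ‖τ • w j‖ < r → x + τ • w j ∈ closure F) := by
  obtain ⟨y, hyF, hy⟩ := Metric.mem_closure_iff.1 hx r h.pos
  obtain ⟨i, j, hij, K, hK, hKS, hqK, ε₀, hε₀, hs⟩ := h.exists_sector (q := y - x)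
    (by rwa [← dist_eq_norm, dist_comm]) (by simpa using face_subset_compl hF hyF)
  have hKF : K ⊆ F := subset_face hF hK hKS ⟨y, by simpa using hqK, hyF⟩
  have hev : ∀ᶠ ε : ℝ in nhdsWithin 0 (Set.Ioi 0), 0 < ε ∧ ε < ε₀ :=
    Ioo_mem_nhdsGT hε₀
  refine ⟨i, j, hij, ⟨ε₀, hε₀, fun ε h0 h1 τ hτ hn => hKF ((hs ε h0 h1).1 τ hτ hn)⟩,
    fun τ hτ hn => ?_, fun τ hτ hn => ?_⟩
  · refine mem_closure_of_tendsto (tendsto_add_rot_mul x (τ • w i) (-1)) ?_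
    filter_upwards [hev] with ε hε
    rw [neg_one_mul]
    exact hKF ((hs ε hε.1 hε.2).1 τ hτ hn)
  · refine mem_closure_of_tendsto (tendsto_add_rot_mul x (τ • w j) 1) ?_
    filter_upwards [hev] with ε hε
    rw [one_mul]
    exact hKF ((hs ε hε.1 hε.2).2 τ hτ hn)

end Faces

/-- Around a vertex, the drawing is a star with one radius for each incident edge. -/
lemma exists_localStar_pos [Finite V] (G : PlaneGraph V) (v : V) :
    ∃ (w : G.graph.incidenceSet v → Plane) (r : ℝ), LocalStar G.support (G.pos v) w r ∧
      ∀ e : G.graph.incidenceSet v, ∀ u, ‖u‖ < r → u ≠ 0 →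
        (G.pos v + u ∈ G.arc e ↔ ∃ t : ℝ, 0 < t ∧ u = t • w e) := by
  have hray : ∀ e : G.graph.incidenceSet v, ∃ w : Plane, w ≠ 0 ∧ ∃ ρ : ℝ, 0 < ρ ∧
      ∀ u, ‖u‖ < ρ → u ≠ 0 → (G.pos v + u ∈ G.arc e ↔ ∃ t : ℝ, 0 < t ∧ u = t • w) := by
    rintro ⟨e, he, hv⟩
    obtain ⟨u, rfl⟩ := Sym2.mem_iff_exists.1 hv
    exact (arc_isPolygonalArc he rfl).exists_left_ray
  choose w hw ρ hρ hloc using hray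
  obtain ⟨ρ₁, hρ₁, h₁⟩ := exists_ball_inter_biUnion (Set.toFinite G.graph.edgeSet).toFinset G.arc
    (fun e he => isClosed_arc (by simpa using he)) (G.pos v)
  obtain ⟨ρ₂, hρ₂, h₂⟩ := exists_ball_inter_biUnion (Set.toFinite (Set.univ : Set V)).toFinset
    (fun v => {G.pos v}) (fun e he => isClosed_singleton) (G.pos v)
  obtain ⟨ρ₃, hρ₃, h₃⟩ : ∃ ρ₃ : ℝ, 0 < ρ₃ ∧ ∀ e, ρ₃ ≤ ρ e := by
    rcases isEmpty_or_nonempty (G.graph.incidenceSet v) with h | h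
    · exact ⟨1, one_pos, fun e => h.elim e⟩
    · obtain ⟨e, he⟩ := Finite.exists_min ρ
      exact ⟨ρ e, hρ e, he⟩
  have hr : 0 < min (min ρ₁ ρ₂) ρ₃ := lt_min (lt_min hρ₁ hρ₂) hρ₃
  have hloc' : ∀ e : G.graph.incidenceSet v, ∀ u, ‖u‖ < min (min ρ₁ ρ₂) ρ₃ → u ≠ 0 →
      (G.pos v + u ∈ G.arc e ↔ ∃ t : ℝ, 0 < t ∧ u = t • w e) := fun e u hu h0 =>
    hloc e u ((hu.trans_le (min_le_right _ _)).trans_le (h₃ e)) h0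
  have hpos : ∀ u, ‖u‖ < min (min ρ₁ ρ₂) ρ₃ → u ≠ 0 → G.pos v + u ∉ Set.range G.pos := by
    rintro u hu h0 ⟨v', hv'⟩
    have := h₂ u (hu.trans_le ((min_le_left _ _).trans (min_le_right _ _))) v' (by simp)
      (by simp [hv'])
    rw [Set.mem_singleton_iff.1 this] at hv'
    exact h0 (by simpa using hv')
  refine ⟨w, min (min ρ₁ ρ₂) ρ₃, ⟨hr, pos_mem_support v, hw, ?_, ?_⟩, hloc'⟩
  · intro e e' hne s hs t ht heq
    obtain ⟨τ, hτ, hτr⟩ := exists_pos_norm_smul_lt (s • w e) hr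
    have h0 : τ • s • w e ≠ 0 := smul_ne_zero hτ.ne' (smul_ne_zero hs.ne' (hw e))
    have hm : G.pos v + τ • s • w e ∈ G.arc e :=
      (hloc' e _ hτr h0).2 ⟨τ * s, mul_pos hτ hs, smul_smul _ _ _⟩
    have hm' : G.pos v + τ • s • w e ∈ G.arc e' :=
      (hloc' e' _ hτr h0).2 ⟨τ * t, mul_pos hτ ht, by rw [heq, smul_smul]⟩
    exact hpos _ hτr h0 (G.arc_inter_arc_subset e e.2.1 e' e'.2.1
      (fun h => hne (Subtype.ext h)) ⟨hm, hm'⟩)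
  · intro u hu h0
    constructor
    · rintro (hm | hm)
      · exact absurd hm (hpos u hu h0)
      · simp only [Set.mem_iUnion] at hm
        obtain ⟨e, he, hm⟩ := hm
        have hv : v ∈ e := G.mem_of_pos_mem_arc e he v
          (h₁ u (hu.trans_le ((min_le_left _ _).trans (min_le_left _ _))) e (by simpa using he) hm)
        exact ⟨⟨e, he, hv⟩, (hloc' ⟨e, he, hv⟩ u hu h0).1 hm⟩
    · rintro ⟨e, he⟩
      exact arc_subset_support e.2.1 ((hloc' e u hu h0).2 he)

/-- Around a point in the interior of an edge, the drawing consists of two radii, both belonging to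
that edge. -/
lemma exists_localStar_arc [Finite V] {e : Sym2 V} (he : e ∈ G.graph.edgeSet) {x : Plane}
    (hx : x ∈ G.arc e) (hxV : x ∉ Set.range G.pos) :
    ∃ (w : Bool → Plane) (r : ℝ), LocalStar G.support x w r ∧
      ∀ u, ‖u‖ < r → (x + u ∈ G.support ↔ x + u ∈ G.arc e) := by
  obtain ⟨y, z, hy, hz, hyz, ρ, hρ, hloc⟩ : ∃ y z : Plane, y ≠ x ∧ z ≠ x ∧
      segment ℝ x y ∩ segment ℝ x z = {x} ∧ ∃ ρ : ℝ, 0 < ρ ∧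
      ∀ u, ‖u‖ < ρ → (x + u ∈ G.arc e ↔ x + u ∈ segment ℝ x y ∪ segment ℝ x z) := by
    induction e using Sym2.ind with
    | _ a b =>
      exact (arc_isPolygonalArc he rfl).exists_two_segments hx (fun h => hxV ⟨_, h.symm⟩)
        (fun h => hxV ⟨_, h.symm⟩)
  obtain ⟨ρ₁, hρ₁, h₁⟩ := exists_ball_inter_biUnion (Set.toFinite G.graph.edgeSet).toFinset G.arc
    (fun e he => isClosed_arc (by simpa using he)) x
  obtain ⟨ρ₂, hρ₂, h₂⟩ := exists_ball_inter_biUnion (Set.toFinite (Set.univ : Set V)).toFinset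
    (fun v => {G.pos v}) (fun e he => isClosed_singleton) x
  have hy' : 0 < ‖y - x‖ := norm_pos_iff.2 (sub_ne_zero.2 hy)
  have hz' : 0 < ‖z - x‖ := norm_pos_iff.2 (sub_ne_zero.2 hz)
  obtain ⟨r, hr, hr0, hr1, hr2, hr3, hr4⟩ : ∃ r : ℝ, 0 < r ∧ r ≤ ρ ∧ r ≤ ρ₁ ∧ r ≤ ρ₂ ∧
      r ≤ ‖y - x‖ ∧ r ≤ ‖z - x‖ := by
    refine ⟨min ρ (min ρ₁ (min ρ₂ (min ‖y - x‖ ‖z - x‖))), ?_, ?_⟩ <;> simp [*]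
  have hsup : ∀ u, ‖u‖ < r → (x + u ∈ G.support ↔ x + u ∈ G.arc e) := by
    refine fun u hu => ⟨?_, fun h => arc_subset_support he h⟩
    rintro (⟨v, hv⟩ | hm)
    · have := h₂ u (hu.trans_le hr2) v (by simp) (by simp [hv])
      exact absurd ⟨v, (Set.mem_singleton_iff.1 this).symm⟩ hxV
    · simp only [Set.mem_iUnion] at hm
      obtain ⟨e', he', hm⟩ := hm
      have hxe' := h₁ u (hu.trans_le hr1) e' (by simpa using he') hm
      by_cases hee : e = e'
      · rwa [hee]
      · exact absurd (G.arc_inter_arc_subset e he e' he' hee ⟨hx, hxe'⟩) hxV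
  have hseg : ∀ u, ‖u‖ < r → u ≠ 0 → (x + u ∈ G.support ↔
      (∃ t : ℝ, 0 < t ∧ u = t • (y - x)) ∨ ∃ t : ℝ, 0 < t ∧ u = t • (z - x)) := by
    intro u hu h0
    rw [hsup u hu, hloc u (hu.trans_le hr0), Set.mem_union,
      mem_segment_iff_of_norm_lt (hu.trans_le hr3) h0,
      mem_segment_iff_of_norm_lt (hu.trans_le hr4) h0]
  have hne : ∀ s : ℝ, 0 < s → ∀ t : ℝ, 0 < t → s • (y - x) ≠ t • (z - x) := by
    intro s hs t ht heq
    obtain ⟨τ, hτ, hτr⟩ := exists_pos_norm_smul_lt (s • (y - x)) hr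
    have h0 : τ • s • (y - x) ≠ 0 :=
      smul_ne_zero hτ.ne' (smul_ne_zero hs.ne' (sub_ne_zero.2 hy))
    have h1 : x + τ • s • (y - x) ∈ segment ℝ x y ∩ segment ℝ x z :=
      ⟨(mem_segment_iff_of_norm_lt (hτr.trans_le hr3) h0).2 ⟨τ * s, mul_pos hτ hs, smul_smul _ _ _⟩,
        (mem_segment_iff_of_norm_lt (hτr.trans_le hr4) h0).2
          ⟨τ * t, mul_pos hτ ht, by rw [heq, smul_smul]⟩⟩
    rw [hyz] at h1
    exact h0 (by simpa using h1)
  refine ⟨fun b => if b then y - x else z - x, r,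
    ⟨hr, arc_subset_support he hx, ?_, ?_, ?_⟩, hsup⟩
  · rintro (_ | _)
    · simpa using sub_ne_zero.2 hz
    · simpa using sub_ne_zero.2 hy
  · rintro (_ | _) (_ | _) hij s hs t ht
    · exact absurd rfl hij
    · simpa using (hne t ht s hs).symm
    · simpa using hne s hs t ht
    · exact absurd rfl hij
  · intro u hu h0
    rw [hseg u hu h0]
    simp [or_comm]

lemma arc_diff_range_pos {e : Sym2 V} (he : e ∈ G.graph.edgeSet) {a b : V} (hab : e = s(a, b)) :
    G.arc e \ Set.range G.pos = G.arc e \ {G.pos a, G.pos b} := by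
  ext x
  refine and_congr_right fun hx => not_congr ⟨?_, ?_⟩
  · rintro ⟨v, rfl⟩
    have := G.mem_of_pos_mem_arc e he v hx
    rw [hab, Sym2.mem_iff] at this
    rcases this with rfl | rfl <;> simp
  · rintro (rfl | rfl) <;> exact ⟨_, rfl⟩

lemma pos_mem_closure_arc_diff [Finite V] {e : Sym2 V} (he : e ∈ G.graph.edgeSet) {v : V}
    (hv : v ∈ e) : G.pos v ∈ closure (G.arc e \ Set.range G.pos) := by
  obtain ⟨w, r, h, hloc⟩ := G.exists_localStar_pos v
  obtain ⟨ρ₂, hρ₂, h₂⟩ := exists_ball_inter_biUnion (Set.toFinite (Set.univ : Set V)).toFinset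
    (fun v => {G.pos v}) (fun e he => isClosed_singleton) (G.pos v)
  rw [Metric.mem_closure_iff]
  intro ε hε
  obtain ⟨τ, hτ, hτr⟩ := exists_pos_norm_smul_lt (w ⟨e, he, hv⟩) (lt_min (lt_min h.pos hρ₂) hε)
  have h0 : τ • w ⟨e, he, hv⟩ ≠ 0 := smul_ne_zero hτ.ne' (h.ne_zero _)
  refine ⟨G.pos v + τ • w ⟨e, he, hv⟩, ⟨?_, ?_⟩, ?_⟩
  · exact (hloc ⟨e, he, hv⟩ _ (hτr.trans_le ((min_le_left _ _).trans (min_le_left _ _))) h0).2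
      ⟨τ, hτ, rfl⟩
  · rintro ⟨v', hv'⟩
    have := h₂ _ (hτr.trans_le ((min_le_left _ _).trans (min_le_right _ _))) v' (by simp)
      (by simp [hv'])
    rw [← Set.mem_singleton_iff.1 this] at hv'
    exact h0 (by simpa using hv'.symm)
  · simpa [dist_eq_norm] using hτr.trans_le (min_le_right _ _)

lemma exists_mem_arc_diff [Finite V] {e : Sym2 V} (he : e ∈ G.graph.edgeSet) :
    ∃ x ∈ G.arc e, x ∉ Set.range G.pos := by
  induction e using Sym2.ind with
  | _ a b =>
    have h := pos_mem_closure_arc_diff he (Sym2.mem_mk_left a b)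
    obtain ⟨x, hx, hx'⟩ := closure_nonempty_iff.1 ⟨_, h⟩
    exact ⟨x, hx, hx'⟩

/-- If a face is adherent to one interior point of an edge, then the whole edge is on its
boundary: being adherent to the face is a locally constant property of interior points. -/
lemma arc_subset_closure [Finite V] {F : Set Plane} (hF : F ∈ G.faces) {e : Sym2 V}
    (he : e ∈ G.graph.edgeSet) {x : Plane} (hx : x ∈ G.arc e) (hxV : x ∉ Set.range G.pos)
    (hxF : x ∈ closure F) : G.arc e ⊆ closure F := by
  have hconn : IsPreconnected (G.arc e \ Set.range G.pos) := by
    induction e using Sym2.ind with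
    | _ a b =>
      rw [arc_diff_range_pos he rfl]
      exact (arc_isPolygonalArc he rfl).isPreconnected_diff
  have hsub : G.arc e \ Set.range G.pos ⊆ closure F := by
    intro y hy
    refine (hconn.induction₂ (fun x y => x ∈ closure F ↔ y ∈ closure F) ?_
      (fun _ _ _ _ _ _ h h' => h.trans h') (fun _ _ _ _ h => h.symm) ⟨hx, hxV⟩ hy).1 hxF
    rintro z ⟨hz, hzV⟩
    by_cases hzF : z ∈ closure F
    · obtain ⟨w, r, h, hloc⟩ := exists_localStar_arc he hz hzV
      obtain ⟨i, j, hij, -, hi, hj⟩ := exists_rays_of_mem_closure hF h hzF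
      have hij' : i ≠ j := fun h => by
        have := hij h
        exact absurd (Subsingleton.elim true false) (by simp)
      filter_upwards [self_mem_nhdsWithin, mem_nhdsWithin_of_mem_nhds (Metric.ball_mem_nhds z h.pos)]
        with y hy hyr
      refine iff_of_true hzF ?_
      rcases eq_or_ne y z with rfl | hyz
      · exact hzF
      have hn : ‖y - z‖ < r := by rwa [← dist_eq_norm]
      obtain ⟨k, t, ht, hk⟩ := (h.mem_iff (y - z) hn (sub_ne_zero.2 hyz)).1
        (by simpa using arc_subset_support he hy.1)
      rw [← add_sub_cancel z y, hk]
      rw [hk] at hn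
      rcases (by decide : ∀ i j k : Bool, i ≠ j → k = i ∨ k = j) i j k hij'
        with rfl | rfl
      · exact hi t ht hn
      · exact hj t ht hn
    · filter_upwards [mem_nhdsWithin_of_mem_nhds (isClosed_closure.isOpen_compl.mem_nhds hzF)]
        with y hy
      exact iff_of_false hzF hy
  intro y hy
  by_cases hyV : y ∈ Set.range G.pos
  · obtain ⟨v, rfl⟩ := hyV
    exact closure_minimal hsub isClosed_closure
      (pos_mem_closure_arc_diff he (G.mem_of_pos_mem_arc e he v hy))
  · exact hsub ⟨hy, hyV⟩

end PlaneGraph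

/-! ### Face lengths -/

lemma isPreconnected_punctured_ball (x : Plane) (r : ℝ) :
    IsPreconnected (Metric.ball x r \ {x}) := by
  obtain ⟨q, hq⟩ := exists_ne (0 : Plane)
  have heq : Metric.ball x r \ {x}
      = (fun p : ℝ × ℝ => x + p.1 • rot p.2 q) '' (Set.Ioo 0 (r / ‖q‖) ×ˢ Set.univ) := by
    have hnq : 0 < ‖q‖ := norm_pos_iff.2 hq
    have hnorm : ∀ s t : ℝ, 0 < s → ‖s • rot t q‖ = s * ‖q‖ := fun s t hs => by
      rw [norm_smul, norm_rot, Real.norm_of_nonneg hs.le]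
    ext y
    constructor
    · rintro ⟨hy, hyx⟩
      obtain ⟨ρ, hρ, t, -, h⟩ := exists_eq_smul_rot hq (sub_ne_zero.2 hyx) 0
      rw [Metric.mem_ball, dist_eq_norm, h, hnorm ρ t hρ] at hy
      exact ⟨(ρ, t), ⟨⟨hρ, (lt_div_iff₀ hnq).2 hy⟩, trivial⟩, by simp [← h]⟩
    · rintro ⟨⟨s, t⟩, ⟨⟨hs, hs'⟩, -⟩, rfl⟩
      refine ⟨?_, ?_⟩
      · simp only at hs hs' ⊢
        rw [Metric.mem_ball, dist_eq_norm, add_sub_cancel_left, hnorm s t hs]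
        exact (lt_div_iff₀ hnq).1 hs'
      · simpa using ⟨hs.ne', rot_ne_zero hq t⟩
  rw [heq]
  refine (isPreconnected_Ioo.prod isPreconnected_univ).image _ (Continuous.continuousOn ?_)
  exact continuous_const.add (continuous_fst.smul ((continuous_rot_left q).comp continuous_snd))

namespace PlaneGraph

variable {V : Type*} {G : PlaneGraph V} {F : Set Plane}

lemma faces_ncard_le_two [Finite V] {e : Sym2 V} (he : e ∈ G.graph.edgeSet)
    (s : Finset (Set Plane)) (hs : ∀ F ∈ s, F ∈ G.faces ∧ e ∈ G.boundaryEdges F) : s.card ≤ 2 := by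
  obtain ⟨x, hx, hxV⟩ := exists_mem_arc_diff he
  obtain ⟨w, r, h, -⟩ := exists_localStar_arc he hx hxV
  have hray : ∀ F ∈ s, ∃ i, TouchesRay F x (w i) r := fun F hF => by
    obtain ⟨i, j, -, hi, -⟩ := exists_rays_of_mem_closure (hs F hF).1 h
      (((mem_boundaryEdges_iff (hs F hF).1).1 (hs F hF).2).2 hx)
    exact ⟨i, hi⟩
  choose! f hf using hray
  have := Finset.card_le_card_of_injOn (t := (Finset.univ : Finset Bool)) f (fun _ _ => by simp)
    (fun F hF F' hF' hFF' => (hf F hF).face_eq (hs F hF).1 (hs F' hF').1 h.pos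
      (by rw [hFF']; exact hf F' hF'))
  simpa using this

open Classical in
lemma faceLength_eq_sum [Fintype V] (F : Set Plane) :
    G.faceLength F = ∑ e ∈ G.graph.edgeSet.toFinset,
      ((if e ∈ G.boundaryEdges F then 1 else 0) + (if e ∈ G.doubleEdges F then 1 else 0)) := by
  rw [Finset.sum_add_distrib, Finset.sum_boole, Finset.sum_boole, faceLength]
  congr 1
  · rw [← Set.ncard_coe_finset]
    congr 1
    ext e
    simp only [Finset.coe_filter, Set.mem_toFinset, Set.mem_ofPred_eq]
    exact ⟨fun h => ⟨h.1, h⟩, fun h => h.2⟩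
  · rw [← Set.ncard_coe_finset]
    congr 1
    ext e
    simp only [Finset.coe_filter, Set.mem_toFinset, Set.mem_ofPred_eq]
    exact ⟨fun h => ⟨h.1.1, h⟩, fun h => h.2⟩

/-- Every edge has two sides. -/
lemma sum_faceLength_le [Fintype V] (s : Finset (Set Plane)) (hs : ∀ F ∈ s, F ∈ G.faces) :
    ∑ F ∈ s, G.faceLength F ≤ 2 * G.numEdges := by
  classical
  simp_rw [faceLength_eq_sum]
  rw [Finset.sum_comm, numEdges, Set.ncard_eq_toFinset_card', mul_comm, ← smul_eq_mul]
  refine Finset.sum_le_card_nsmul _ _ _ fun e he => ?_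
  rw [Set.mem_toFinset] at he
  by_cases hd : ∃ F₀ ∈ s, e ∈ G.doubleEdges F₀
  · obtain ⟨F₀, hF₀, hd⟩ := hd
    rw [Finset.sum_eq_single_of_mem F₀ hF₀]
    · split_ifs <;> omega
    · intro F hF hne
      have hb : e ∉ G.boundaryEdges F := fun hb => hne (hd.2 F (hs F hF) hb)
      rw [if_neg hb, if_neg fun h => hb h.1, add_zero]
  · push Not at hd
    have : ∀ F ∈ s, ((if e ∈ G.boundaryEdges F then 1 else 0)
        + (if e ∈ G.doubleEdges F then 1 else 0)) = if e ∈ G.boundaryEdges F then 1 else 0 :=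
      fun F hF => by rw [if_neg (hd F hF), add_zero]
    rw [Finset.sum_congr rfl this, Finset.sum_boole]
    refine faces_ncard_le_two he _ fun F hF => ?_
    rw [Finset.mem_filter] at hF
    exact ⟨hs F hF.1, hF.2⟩

/-- At a non-isolated vertex on the boundary of `F`, the boundary of `F` either turns from one
edge to another or runs back along the only edge. -/
lemma exists_corner [Finite V] (hF : F ∈ G.faces) {v : V} (hv : v ∈ G.graph.support)
    (hvF : G.pos v ∈ closure F) : ∃ e ∈ G.boundaryEdges F, ∃ e' ∈ G.boundaryEdges F, v ∈ e ∧ v ∈ e' ∧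
      (e = e' → e ∈ G.doubleEdges F ∧ ∀ e'' ∈ G.graph.edgeSet, v ∈ e'' → e'' = e) := by
  obtain ⟨u, hu⟩ := hv
  have : Nonempty (G.graph.incidenceSet v) := ⟨⟨s(v, u), hu, Sym2.mem_mk_left v u⟩⟩
  obtain ⟨w, r, h, hloc⟩ := G.exists_localStar_pos v
  obtain ⟨i, j, hij, hi, hi', hj'⟩ := exists_rays_of_mem_closure hF h hvF
  have hb : ∀ k : G.graph.incidenceSet v,
      (∀ τ : ℝ, 0 < τ → ‖τ • w k‖ < r → G.pos v + τ • w k ∈ closure F) →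
      (k : Sym2 V) ∈ G.boundaryEdges F := by
    intro k hk
    rw [mem_boundaryEdges_iff hF]
    refine ⟨k.2.1, ?_⟩
    obtain ⟨ρ₂, hρ₂, h₂⟩ := exists_ball_inter_biUnion (Set.toFinite (Set.univ : Set V)).toFinset
      (fun v => {G.pos v}) (fun e he => isClosed_singleton) (G.pos v)
    obtain ⟨τ, hτ, hτr⟩ := exists_pos_norm_smul_lt (w k) (lt_min h.pos hρ₂)
    have h0 : τ • w k ≠ 0 := smul_ne_zero hτ.ne' (h.ne_zero k)
    have hτ₁ := hτr.trans_le (min_le_left _ _)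
    refine arc_subset_closure hF k.2.1 ((hloc k _ hτ₁ h0).2 ⟨τ, hτ, rfl⟩) ?_ (hk τ hτ hτ₁)
    rintro ⟨v', hv'⟩
    have := h₂ _ (hτr.trans_le (min_le_right _ _)) v' (by simp) (by simp [hv'])
    rw [← Set.mem_singleton_iff.1 this] at hv'
    exact h0 (by simpa using hv'.symm)
  refine ⟨i, hb i hi', j, hb j hj', i.2.2, j.2.2, fun heq => ?_⟩
  have hsub := hij (Subtype.ext heq)
  refine ⟨⟨hb i hi', fun F' hF' hb' => ?_⟩, fun e'' he'' hv'' => ?_⟩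
  · have hvF' : G.pos v ∈ closure F' :=
      ((mem_boundaryEdges_iff hF').1 hb').2 (pos_mem_arc i.2.1 i.2.2)
    obtain ⟨i', j', -, h', -⟩ := exists_rays_of_mem_closure hF' h hvF'
    rw [Subsingleton.elim i' i] at h'
    exact h'.face_eq hF' hF h.pos hi
  · exact congrArg Subtype.val (Subsingleton.elim (⟨e'', he'', hv''⟩ : G.graph.incidenceSet v) i)

open Classical in
lemma card_filter_mem_sym2_le_two (s : Finset V) (e : Sym2 V) : (s.filter (· ∈ e)).card ≤ 2 := by
  induction e using Sym2.ind with
  | _ a b =>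
    refine (Finset.card_le_card (t := {a, b}) fun v hv => ?_).trans Finset.card_le_two
    simpa using (Finset.mem_filter.1 hv).2

/-- The boundary walks of a face visit each of its non-isolated vertices. -/
lemma card_le_faceLength [Fintype V] (hF : F ∈ G.faces) (s : Finset V)
    (hs : ∀ v ∈ s, v ∈ G.graph.support ∧ G.pos v ∈ closure F) : s.card ≤ G.faceLength F := by
  classical
  have h1 : 2 * s.card ≤ ∑ v ∈ s, ∑ e ∈ G.graph.edgeSet.toFinset,
      (if v ∈ e then ((if e ∈ G.boundaryEdges F then 1 else 0)
        + (if e ∈ G.doubleEdges F then 1 else 0)) else 0) := by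
    rw [mul_comm, ← smul_eq_mul]
    refine Finset.card_nsmul_le_sum _ _ _ fun v hv => ?_
    obtain ⟨e, he, e', he', hve, hve', hd⟩ := exists_corner hF (hs v hv).1 (hs v hv).2
    by_cases heq : e = e'
    · refine le_trans ?_ (Finset.single_le_sum (fun _ _ => Nat.zero_le _)
        (Set.mem_toFinset.2 he.1))
      rw [if_pos hve, if_pos he, if_pos (hd heq).1]
    · refine le_trans ?_ (Finset.sum_le_sum_of_subset (s := {e, e'}) ?_)
      · rw [Finset.sum_pair heq, if_pos hve, if_pos hve', if_pos he, if_pos he']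
        omega
      · intro e'' he''
        rw [Finset.mem_insert, Finset.mem_singleton] at he''
        rcases he'' with rfl | rfl
        · exact Set.mem_toFinset.2 he.1
        · exact Set.mem_toFinset.2 he'.1
  have h2 : ∑ v ∈ s, ∑ e ∈ G.graph.edgeSet.toFinset,
      (if v ∈ e then ((if e ∈ G.boundaryEdges F then 1 else 0)
        + (if e ∈ G.doubleEdges F then 1 else 0)) else 0) ≤ 2 * G.faceLength F := by
    rw [Finset.sum_comm, faceLength_eq_sum, Finset.mul_sum]
    refine Finset.sum_le_sum fun e _ => ?_
    rw [← Finset.sum_filter, Finset.sum_const, smul_eq_mul]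
    exact Nat.mul_le_mul_right _ (card_filter_mem_sym2_le_two s e)
  omega

/-- If `F` is the only face adherent to the centre of a local star whose radii are on the boundary
of `F`, then a neighbourhood of that point lies in the closure of `F`. -/
lemma closure_mem_nhds_of_unique [Finite V] {ι : Type*} {x : Plane} {w : ι → Plane} {r : ℝ}
    (h : LocalStar G.support x w r) (hsupp : ∀ u, ‖u‖ < r → x + u ∈ G.support → x + u ∈ closure F)
    (huniq : ∀ F' ∈ G.faces, x ∈ closure F' → F' = F) : closure F ∈ nhds x := by
  filter_upwards [Metric.ball_mem_nhds x h.pos] with y hy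
  have hn : ‖y - x‖ < r := by rwa [← dist_eq_norm]
  have hxy : x + (y - x) = y := add_sub_cancel x y
  by_cases hyS : y ∈ G.support
  · rw [← hxy]
    exact hsupp _ hn (by rwa [hxy])
  · obtain ⟨F', hF', hyF'⟩ := exists_face_mem hyS
    have hyx : y - x ≠ 0 := by
      rw [sub_ne_zero]
      rintro rfl
      exact hyS h.mem
    -- the radius from `x` to `y` avoids the drawing
    have hK : AffineMap.lineMap x y '' Set.Ioc (0 : ℝ) 1 ⊆ F' := by
      refine subset_face hF' ((convex_Ioc 0 1).affine_image _).isPreconnected ?_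
        ⟨y, ⟨1, by simp, by simp⟩, hyF'⟩
      rintro _ ⟨t, ht, rfl⟩ hS
      rw [AffineMap.lineMap_apply, vsub_eq_sub, vadd_eq_add, add_comm] at hS
      have hn' : ‖t • (y - x)‖ < r := by
        rw [norm_smul, Real.norm_of_nonneg ht.1.le]
        exact (mul_le_of_le_one_left (norm_nonneg _) ht.2).trans_lt hn
      obtain ⟨i, s, hs, hsi⟩ := (h.mem_iff _ hn' (smul_ne_zero ht.1.ne' hyx)).1 hS
      refine hyS ?_
      rw [← hxy]
      refine (h.mem_iff _ hn hyx).2 ⟨i, t⁻¹ * s, mul_pos (inv_pos.2 ht.1) hs, ?_⟩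
      rw [mul_smul, ← hsi, smul_smul, inv_mul_cancel₀ ht.1.ne', one_smul]
    have hxF' : x ∈ closure F' := by
      have hc : Continuous (AffineMap.lineMap x y : ℝ → Plane) := AffineMap.lineMap_continuous
      have ht : Filter.Tendsto (AffineMap.lineMap x y : ℝ → Plane)
          (nhdsWithin 0 (Set.Ioi 0)) (nhds x) := by
        have := (hc.tendsto 0).mono_left (nhdsWithin_le_nhds (s := Set.Ioi 0))
        rwa [AffineMap.lineMap_apply_zero] at this
      refine mem_closure_of_tendsto ht ?_
      filter_upwards [Ioc_mem_nhdsGT (zero_lt_one' ℝ)] with t ht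
      exact hK ⟨t, ht, rfl⟩
    rw [← huniq F' hF' hxF']
    exact subset_closure hyF'

/-- With at least two edges there are no faces of length less than three: the closure of such a
face would be open, hence the whole plane. -/
lemma three_le_faceLength [Fintype V] (hE : 2 ≤ G.numEdges) (hF : F ∈ G.faces) :
    3 ≤ G.faceLength F := by
  classical
  by_contra! hlen
  have hthree : ∀ s : Finset V, (∀ v ∈ s, v ∈ G.graph.support ∧ G.pos v ∈ closure F) →
      s.card ≤ 2 := fun s hs => (card_le_faceLength hF s hs).trans (by omega)
  have hmem : ∀ e ∈ G.boundaryEdges F, ∀ v ∈ e, v ∈ G.graph.support ∧ G.pos v ∈ closure F := by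
    intro e he v hv
    refine ⟨?_, ((mem_boundaryEdges_iff hF).1 he).2 (pos_mem_arc he.1 hv)⟩
    obtain ⟨u, rfl⟩ := Sym2.mem_iff_exists.1 hv
    exact ⟨u, he.1⟩
  have hcorner : ∀ v ∈ G.graph.support, G.pos v ∈ closure F → ∃ e ∈ G.doubleEdges F, v ∈ e ∧
      ∀ e'' ∈ G.graph.edgeSet, v ∈ e'' → e'' = e := by
    intro v hv hvF
    obtain ⟨e, he, e', he', hve, hve', hd⟩ := exists_corner hF hv hvF
    by_cases heq : e = e'
    · exact ⟨e, (hd heq).1, hve, (hd heq).2⟩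
    · exfalso
      obtain ⟨a, rfl⟩ := Sym2.mem_iff_exists.1 hve
      obtain ⟨b, rfl⟩ := Sym2.mem_iff_exists.1 hve'
      have h3 : ({v, a, b} : Finset V).card = 3 := by
        refine Finset.card_eq_three.2 ⟨v, a, b, ?_, ?_, ?_, rfl⟩
        · exact G.graph.ne_of_adj he.1
        · exact G.graph.ne_of_adj he'.1
        · rintro rfl
          exact heq rfl
      have := hthree {v, a, b} (by
        intro u hu
        simp only [Finset.mem_insert, Finset.mem_singleton] at hu
        rcases hu with rfl | rfl | rfl
        · exact ⟨hv, hvF⟩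
        · exact hmem _ he _ (Sym2.mem_mk_right _ _)
        · exact hmem _ he' _ (Sym2.mem_mk_right _ _))
      omega
  have hopen : IsOpen (closure F) := by
    rw [isOpen_iff_mem_nhds]
    intro x hx
    by_cases hxS : x ∈ G.support
    swap
    · have hxF : x ∈ F := by
        obtain ⟨F', hF', hxF'⟩ := exists_face_mem hxS
        obtain ⟨y, hy, hy'⟩ := mem_closure_iff.1 hx F' (isOpen_of_mem_faces hF') hxF'
        exact face_eq_of_mem hF' hF hy hy' ▸ hxF'
      exact Filter.mem_of_superset ((isOpen_of_mem_faces hF).mem_nhds hxF) subset_closure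
    by_cases hxV : x ∈ Set.range G.pos
    · obtain ⟨v, rfl⟩ := hxV
      obtain ⟨w, r, h, hloc⟩ := G.exists_localStar_pos v
      by_cases hv : v ∈ G.graph.support
      · obtain ⟨e, he, hve, hmin⟩ := hcorner v hv hx
        have hall : ∀ i : G.graph.incidenceSet v, i = ⟨e, he.1.1, hve⟩ :=
          fun i => Subtype.ext (hmin i i.2.1 i.2.2)
        refine closure_mem_nhds_of_unique h (fun u hu huS => ?_) fun F' hF' hxF' => ?_
        · rcases eq_or_ne u 0 with rfl | h0
          · simpa using hx
          obtain ⟨i, ht⟩ := (h.mem_iff u hu h0).1 huS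
          rw [hall i] at ht
          exact ((mem_boundaryEdges_iff hF).1 he.1).2 ((hloc ⟨e, he.1.1, hve⟩ u hu h0).2 ht)
        · obtain ⟨e', he', -, -, hve', -, -⟩ := exists_corner hF' hv hxF'
          rw [hmin e' he'.1 hve'] at he'
          exact he.2 F' hF' he'
      · have hK : Metric.ball (G.pos v) r \ {G.pos v} ⊆ F := by
          refine subset_face hF (isPreconnected_punctured_ball _ _) ?_ ?_
          · rintro y ⟨hy, hyv⟩ hyS
            rw [Metric.mem_ball, dist_eq_norm] at hy
            obtain ⟨⟨e, he, hve⟩, -⟩ := (h.mem_iff _ hy (sub_ne_zero.2 hyv)).1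
              (by rwa [add_sub_cancel])
            obtain ⟨u, rfl⟩ := Sym2.mem_iff_exists.1 hve
            exact hv ⟨u, he⟩
          · obtain ⟨y, hyF, hy⟩ := Metric.mem_closure_iff.1 hx r h.pos
            refine ⟨y, ⟨by rwa [Metric.mem_ball, dist_comm], ?_⟩, hyF⟩
            rintro rfl
            exact face_subset_compl hF hyF hxS
        filter_upwards [Metric.ball_mem_nhds _ h.pos] with y hy
        rcases eq_or_ne y (G.pos v) with rfl | hyv
        · exact hx
        · exact subset_closure (hK ⟨hy, hyv⟩)
    · have hxe : ∃ e ∈ G.graph.edgeSet, x ∈ G.arc e := by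
        simpa using hxS.resolve_left hxV
      obtain ⟨e, he, hxe⟩ := hxe
      obtain ⟨w, r, h, hloc⟩ := exists_localStar_arc he hxe hxV
      have hb : e ∈ G.boundaryEdges F :=
        (mem_boundaryEdges_iff hF).2 ⟨he, arc_subset_closure hF he hxe hxV hx⟩
      obtain ⟨v, hve⟩ : ∃ v, v ∈ e := ⟨_, e.out_fst_mem⟩
      obtain ⟨e', he', -, hmin⟩ := hcorner v (hmem e hb v hve).1 (hmem e hb v hve).2
      rw [← hmin e he hve] at he'
      refine closure_mem_nhds_of_unique h (fun u hu huS => ?_) fun F' hF' hxF' => ?_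
      · exact ((mem_boundaryEdges_iff hF).1 hb).2 ((hloc u hu).1 huS)
      · exact he'.2 F' hF'
          ((mem_boundaryEdges_iff hF').2 ⟨he, arc_subset_closure hF' he hxe hxV hxF'⟩)
  have huniv : closure F = Set.univ :=
    IsClopen.eq_univ ⟨isClosed_closure, hopen⟩ (nonempty_of_mem_faces hF).closure
  obtain ⟨e, he, e', he', hne⟩ := (Set.one_lt_ncard (Set.toFinite _)).1
    (show 1 < G.graph.edgeSet.ncard from hE)
  have hcard := hthree (Finset.univ.filter (· ∈ G.graph.support)) (by simp [huniv])
  have hpair : ∀ e ∈ G.graph.edgeSet, ∃ a b, e = s(a, b) ∧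
      ({a, b} : Finset V) = Finset.univ.filter (· ∈ G.graph.support) := by
    intro e he
    induction e using Sym2.ind with
    | _ a b =>
      refine ⟨a, b, rfl, Finset.eq_of_subset_of_card_le ?_ ?_⟩
      · intro v hv
        simp only [Finset.mem_insert, Finset.mem_singleton] at hv
        rw [Finset.mem_filter]
        rcases hv with rfl | rfl
        · exact ⟨Finset.mem_univ _, _, he⟩
        · exact ⟨Finset.mem_univ _, _, SimpleGraph.Adj.symm he⟩
      · rw [Finset.card_pair (G.graph.ne_of_adj he)]
        exact hcard
  obtain ⟨a, b, rfl, hab⟩ := hpair e he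
  obtain ⟨c, d, rfl, hcd⟩ := hpair e' he'
  have h1 : a ∈ ({c, d} : Finset V) := by rw [hcd, ← hab]; simp
  have h2 : b ∈ ({c, d} : Finset V) := by rw [hcd, ← hab]; simp
  have hne' := G.graph.ne_of_adj he
  simp only [Finset.mem_insert, Finset.mem_singleton] at h1 h2
  rcases h1 with rfl | rfl <;> rcases h2 with rfl | rfl
  · exact hne' rfl
  · exact hne rfl
  · exact hne Sym2.eq_swap
  · exact hne' rfl

end PlaneGraph

/-! ### Angles subtended by polygonal arcs -/

/-- The oriented angle in `(-π, π]` under which the segment from `P` to `Q` is seen from `x`. -/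
noncomputable def segAngle (P Q x : Plane) : ℝ := (toC (Q - x) / toC (P - x)).arg

/-- The angle by which the direction towards `P` turns when the viewpoint moves from `x₀` to `x`. -/
noncomputable def turnAngle (x₀ P x : Plane) : ℝ := (toC (P - x) / toC (P - x₀)).arg

lemma turnAngle_self (x₀ P : Plane) : turnAngle x₀ P x₀ = 0 := by
  rw [turnAngle]
  by_cases h : toC (P - x₀) = 0
  · simp [h]
  · rw [div_self h, Complex.arg_one]

lemma toC_sub_ne_zero {P x : Plane} (h : P ≠ x) : toC (P - x) ≠ 0 := by
  simpa [sub_eq_zero] using h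

lemma continuousAt_turnAngle {x₀ P : Plane} (h : P ≠ x₀) : ContinuousAt (turnAngle x₀ P) x₀ := by
  have h0 := toC_sub_ne_zero h
  have : Continuous fun x => toC (P - x) / toC (P - x₀) :=
    (toC.continuous.comp (continuous_const.sub continuous_id)).div_const _
  refine ContinuousAt.comp (g := Complex.arg) ?_ this.continuousAt
  rw [div_self h0]
  exact Complex.continuousAt_arg (by simp)

lemma div_mem_slitPlane {P Q x : Plane} (h : x ∉ segment ℝ P Q) :
    toC (Q - x) / toC (P - x) ∈ Complex.slitPlane := by
  have hP : P ≠ x := by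
    rintro rfl
    exact h (left_mem_segment ℝ _ _)
  have h0 := toC_sub_ne_zero hP
  by_contra hc
  rw [Complex.mem_slitPlane_iff, not_or, not_lt, not_not] at hc
  set c := -(toC (Q - x) / toC (P - x)).re with hcdef
  have hc0 : 0 ≤ c := by linarith [hc.1]
  have h1 : toC (Q - x) / toC (P - x) = ((-c : ℝ) : ℂ) := by
    apply Complex.ext
    · simp [hcdef]
    · rw [hc.2, Complex.ofReal_im]
  rw [div_eq_iff h0, ← Complex.real_smul, ← map_smul] at h1
  have h2 : Q - x = (-c) • (P - x) := toC.injective h1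
  refine h ⟨c / (1 + c), 1 / (1 + c), by positivity, by positivity, by field_simp; ring, ?_⟩
  have h3 : Q = x + (-c) • (P - x) := by rw [← h2]; abel
  have hc1 : (1 + c) ≠ 0 := by positivity
  rw [h3]
  clear_value c
  match_scalars <;> field_simp
  ring

lemma continuousAt_segAngle {P Q x : Plane} (h : x ∉ segment ℝ P Q) :
    ContinuousAt (segAngle P Q) x := by
  have hP : P ≠ x := by
    rintro rfl
    exact h (left_mem_segment ℝ _ _)
  have h1 : ContinuousAt (fun y => toC (Q - y) / toC (P - y)) x :=
    (toC.continuous.comp (continuous_const.sub continuous_id)).continuousAt.div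
      (toC.continuous.comp (continuous_const.sub continuous_id)).continuousAt (toC_sub_ne_zero hP)
  exact ContinuousAt.comp (g := Complex.arg) (Complex.continuousAt_arg (div_mem_slitPlane h)) h1

/-- Off the segment, the angle under which it is seen changes by the difference of the turns of
the directions towards its ends: both sides agree modulo `2π` and vary continuously. -/
lemma eventually_segAngle_eq {P Q x₀ : Plane} (h : x₀ ∉ segment ℝ P Q) :
    ∀ᶠ x in nhds x₀,
      segAngle P Q x = segAngle P Q x₀ + (turnAngle x₀ Q x - turnAngle x₀ P x) := by
  have hP : P ≠ x₀ := by
    rintro rfl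
    exact h (left_mem_segment ℝ _ _)
  have hQ : Q ≠ x₀ := by
    rintro rfl
    exact h (right_mem_segment ℝ _ _)
  set D : Plane → ℝ := fun x =>
    segAngle P Q x - (segAngle P Q x₀ + (turnAngle x₀ Q x - turnAngle x₀ P x)) with hD
  have hDc : ContinuousAt D x₀ := (continuousAt_segAngle h).sub
    (continuousAt_const.add ((continuousAt_turnAngle hQ).sub (continuousAt_turnAngle hP)))
  have hD0 : D x₀ = 0 := by simp [hD, turnAngle_self]
  have hsmall : ∀ᶠ x in nhds x₀, |D x| < 2 * Real.pi := by
    have := hDc.abs.tendsto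
    rw [hD0, abs_zero] at this
    exact this.eventually_lt_const Real.two_pi_pos
  filter_upwards [hsmall, isOpen_ne.mem_nhds hP.symm, isOpen_ne.mem_nhds hQ.symm]
    with x hx hxP hxQ
  have e1 := toC_sub_ne_zero hP
  have e2 := toC_sub_ne_zero hQ
  have e3 := toC_sub_ne_zero (P := P) (x := x) hxP.symm
  have e4 := toC_sub_ne_zero (P := Q) (x := x) hxQ.symm
  have hang : ((segAngle P Q x : ℝ) : Real.Angle)
      = ((segAngle P Q x₀ + (turnAngle x₀ Q x - turnAngle x₀ P x) : ℝ) : Real.Angle) := by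
    simp only [segAngle, turnAngle, Real.Angle.coe_add, Real.Angle.coe_sub,
      Complex.arg_div_coe_angle, e1, e2, e3, e4, ne_eq, not_false_eq_true]
    abel
  obtain ⟨n, hn⟩ := Real.Angle.angle_eq_iff_two_pi_dvd_sub.1 hang
  have hDn : D x = 2 * Real.pi * n := hn
  rw [hDn, abs_mul, abs_of_pos Real.two_pi_pos] at hx
  have hn1 : |(n : ℝ)| < 1 := by
    by_contra hc
    have := mul_le_mul_of_nonneg_left (not_lt.1 hc) Real.two_pi_pos.le
    linarith
  have hn0 : n = 0 := by
    have : |n| < 1 := by exact_mod_cast hn1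
    exact Int.abs_lt_one_iff.1 this
  rw [hn0] at hn
  simp only [Int.cast_zero, mul_zero] at hn
  linarith

lemma midpoint_eq_add_half_smul (P Q : Plane) : midpoint ℝ P Q = P + (1 / 2 : ℝ) • (Q - P) := by
  rw [midpoint_eq_smul_add, invOf_eq_inv]
  module

/-- The vector `v` turned by a right angle. -/
noncomputable def normalVec (v : Plane) : Plane := toC.symm (Complex.I * toC v)

lemma add_smul_normalVec_notMem_segment {P Q : Plane} (hPQ : P ≠ Q) {t : ℝ} (ht : t ≠ 0) :
    midpoint ℝ P Q + t • normalVec (Q - P) ∉ segment ℝ P Q := by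
  intro h
  rw [segment_eq_image'] at h
  obtain ⟨s, -, hs⟩ := h
  have h1 := congrArg toC hs
  have hd := toC_sub_ne_zero hPQ.symm
  have hm := midpoint_eq_add_half_smul P Q
  rw [hm] at h1
  simp only [normalVec, map_add, map_smul, LinearIsometryEquiv.apply_symm_apply,
    Complex.real_smul] at h1
  have h2 : ((s : ℂ) - ((1 / 2 : ℝ) : ℂ) - t * Complex.I) * toC (Q - P) = 0 := by
    linear_combination h1
  have h3 := congrArg Complex.im ((mul_eq_zero.1 h2).resolve_right hd)
  simp at h3
  exact ht h3

/-- The angle under which a segment is seen jumps by `2π` when the segment is crossed. -/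
lemma tendsto_segAngle_sub {P Q : Plane} (hPQ : P ≠ Q) :
    Filter.Tendsto (fun t : ℝ =>
      segAngle P Q (midpoint ℝ P Q + t • normalVec (Q - P))
        - segAngle P Q (midpoint ℝ P Q + (-t) • normalVec (Q - P)))
      (nhdsWithin 0 (Set.Ioi 0)) (nhds (2 * Real.pi)) := by
  have hd := toC_sub_ne_zero hPQ.symm
  have hm := midpoint_eq_add_half_smul P Q
  set g : ℝ → ℂ := fun t => (1 / 2 - t * Complex.I) / (-(1 / 2) - t * Complex.I) with hg
  have hden : ∀ t : ℝ, (-(1 / 2) - t * Complex.I : ℂ) ≠ 0 := by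
    intro t h
    have := congrArg Complex.re h
    norm_num at this
  have hseg : ∀ t : ℝ, segAngle P Q (midpoint ℝ P Q + t • normalVec (Q - P)) = (g t).arg := by
    intro t
    have h1 : toC (Q - (midpoint ℝ P Q + t • normalVec (Q - P)))
        = (1 / 2 - t * Complex.I) * toC (Q - P) := by
      rw [hm]
      simp only [normalVec, map_sub, map_add, map_smul, LinearIsometryEquiv.apply_symm_apply,
        Complex.real_smul]
      push_cast
      ring
    have h2 : toC (P - (midpoint ℝ P Q + t • normalVec (Q - P)))
        = (-(1 / 2) - t * Complex.I) * toC (Q - P) := by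
      rw [hm]
      simp only [normalVec, map_sub, map_add, map_smul, LinearIsometryEquiv.apply_symm_apply,
        Complex.real_smul]
      push_cast
      ring
    rw [segAngle, h1, h2, mul_div_mul_right _ _ hd]
  have him : ∀ t : ℝ, (g t).im = t / (1 / 4 + t ^ 2) := by
    intro t
    have : (1 / 4 + t ^ 2 : ℝ) ≠ 0 := by positivity
    simp only [hg, Complex.div_im, Complex.normSq_apply]
    simp
    field_simp
    ring
  have hg0 : g 0 = -1 := by simp [hg]
  have hgc : Continuous g := Continuous.div (by fun_prop) (by fun_prop) hden
  have hg1 : Filter.Tendsto g (nhdsWithin 0 (Set.Ioi 0)) (nhds (-1)) := by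
    rw [← hg0]
    exact (hgc.tendsto 0).mono_left nhdsWithin_le_nhds
  have hg2 : Filter.Tendsto (fun t => g (-t)) (nhdsWithin 0 (Set.Ioi 0)) (nhds (-1)) := by
    rw [← hg0]
    have := ((hgc.comp continuous_neg).tendsto 0).mono_left
      (nhdsWithin_le_nhds (s := Set.Ioi (0 : ℝ)))
    simpa [Function.comp_def] using this
  have h1 : Filter.Tendsto (fun t => (g t).arg) (nhdsWithin 0 (Set.Ioi 0)) (nhds Real.pi) := by
    refine (Complex.tendsto_arg_nhdsWithin_im_nonneg_of_re_neg_of_im_zero (z := -1)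
      (by simp) (by simp)).comp (tendsto_nhdsWithin_iff.2 ⟨hg1, ?_⟩)
    filter_upwards [self_mem_nhdsWithin] with t ht
    have ht : 0 < t := ht
    change 0 ≤ (g t).im
    rw [him]
    positivity
  have h2 : Filter.Tendsto (fun t => (g (-t)).arg) (nhdsWithin 0 (Set.Ioi 0))
      (nhds (-Real.pi)) := by
    refine (Complex.tendsto_arg_nhdsWithin_im_neg_of_re_neg_of_im_zero (z := -1)
      (by simp) (by simp)).comp (tendsto_nhdsWithin_iff.2 ⟨hg2, ?_⟩)
    filter_upwards [self_mem_nhdsWithin] with t ht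
    have ht : 0 < t := ht
    change (g (-t)).im < 0
    rw [him, neg_div]
    have : 0 < t / (1 / 4 + (-t) ^ 2) := by positivity
    linarith
  simp_rw [hseg]
  convert h1.sub h2 using 2
  ring

/-- For every polygonal arc there is a function of the viewpoint, the total angle under which the
arc is seen, which changes off the arc like the difference of the turns of the directions towards
its ends, and which jumps by `2π` at some interior point of the arc. -/
lemma IsPolygonalArc.exists_angle {a b : Plane} {S : Set Plane} (h : IsPolygonalArc a b S) :
    ∃ θ : Plane → ℝ,
      (∀ x₀, x₀ ∉ S → ∀ᶠ x in nhds x₀, θ x = θ x₀ + (turnAngle x₀ b x - turnAngle x₀ a x)) ∧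
      (∀ x₀, x₀ ∉ S → ContinuousAt θ x₀) ∧
      ∃ m ∈ S, m ≠ a ∧ m ≠ b ∧ ∃ ν : Plane,
        (∀ᶠ t : ℝ in nhdsWithin 0 (Set.Ioi 0), m + t • ν ∉ S ∧ m + (-t) • ν ∉ S) ∧
        Filter.Tendsto (fun t : ℝ => θ (m + t • ν) - θ (m + (-t) • ν))
          (nhdsWithin 0 (Set.Ioi 0)) (nhds (2 * Real.pi)) := by
  obtain ⟨r, p, rfl, rfl, hne, hcons, hdis, rfl⟩ := h
  have h01 := hne 0 (Nat.zero_le _)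
  have hseg : ∀ x₀, x₀ ∉ (⋃ i ∈ Finset.range (r + 1), segment ℝ (p i) (p (i + 1))) →
      ∀ i ∈ Finset.range (r + 1), x₀ ∉ segment ℝ (p i) (p (i + 1)) :=
    fun x₀ h0 i hi hx => h0 (Set.mem_biUnion hi hx)
  set m := midpoint ℝ (p 0) (p 1) with hm
  have hm0 : m ≠ p 0 := by simpa [hm, midpoint_eq_left_iff] using h01
  have hm1 : m ≠ p 1 := by simpa [hm, midpoint_eq_right_iff] using h01
  have hms : m ∈ segment ℝ (p 0) (p 1) := midpoint_mem_segment _ _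
  have hother : ∀ i ∈ Finset.range r, m ∉ segment ℝ (p (i + 1)) (p (i + 1 + 1)) := by
    intro i hi hx
    rw [Finset.mem_range] at hi
    rcases i with _ | i
    · have : m ∈ ({p 1} : Set Plane) := by
        rw [← hcons 0 (by omega)]
        exact ⟨hms, hx⟩
      exact hm1 this
    · exact Set.disjoint_left.1 (hdis 0 (i + 2) (by omega) (by omega)) hms hx
  have hcont : ∀ c : ℝ, Continuous fun t : ℝ => m + (c * t) • normalVec (p 1 - p 0) :=
    fun c => by fun_prop
  have hlim : ∀ c : ℝ, Filter.Tendsto (fun t : ℝ => m + (c * t) • normalVec (p 1 - p 0))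
      (nhdsWithin 0 (Set.Ioi 0)) (nhds m) := fun c => by
    have := ((hcont c).tendsto 0).mono_left (nhdsWithin_le_nhds (s := Set.Ioi (0 : ℝ)))
    simpa using this
  have hnot : ∀ c : ℝ, c ≠ 0 → ∀ᶠ t : ℝ in nhdsWithin 0 (Set.Ioi 0),
      m + (c * t) • normalVec (p 1 - p 0) ∉
        ⋃ i ∈ Finset.range (r + 1), segment ℝ (p i) (p (i + 1)) := by
    intro c hc
    have h1 : ∀ᶠ y in nhds m, ∀ i ∈ Finset.range r, y ∉ segment ℝ (p (i + 1)) (p (i + 1 + 1)) := by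
      rw [Filter.eventually_all_finset]
      exact fun i hi => (isClosed_segment_plane _ _).isOpen_compl.mem_nhds (hother i hi)
    filter_upwards [(hlim c).eventually h1, self_mem_nhdsWithin] with t ht ht0 hmem
    simp only [Set.mem_iUnion] at hmem
    obtain ⟨i, hi, hmem⟩ := hmem
    rw [Finset.mem_range] at hi
    rcases i with _ | i
    · exact add_smul_normalVec_notMem_segment h01 (mul_ne_zero hc (ne_of_gt ht0)) hmem
    · exact ht i (Finset.mem_range.2 (by omega)) hmem
  refine ⟨fun x => ∑ i ∈ Finset.range (r + 1), segAngle (p i) (p (i + 1)) x, ?_, ?_, m,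
    Set.mem_biUnion (x := 0) (by simp) hms, hm0, ?_, normalVec (p 1 - p 0), ?_, ?_⟩
  · intro x₀ hx₀
    have := (Filter.eventually_all_finset (Finset.range (r + 1))).2
      fun i hi => eventually_segAngle_eq (hseg x₀ hx₀ i hi)
    filter_upwards [this] with x hx
    rw [Finset.sum_congr rfl hx, Finset.sum_add_distrib,
      Finset.sum_range_sub (fun i => turnAngle x₀ (p i) x)]
  · intro x₀ hx₀
    exact tendsto_finsetSum _ fun i hi => (continuousAt_segAngle (hseg x₀ hx₀ i hi)).tendsto
  · rcases r with _ | r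
    · exact hm1
    · intro heq
      exact hother r (Finset.mem_range.2 (by omega)) (heq ▸ right_mem_segment ℝ _ _)
  · filter_upwards [hnot 1 one_ne_zero, hnot (-1) (by norm_num)] with t h1 h2
    rw [one_mul] at h1
    rw [neg_one_mul] at h2
    exact ⟨h1, h2⟩
  · simp_rw [Finset.sum_range_succ', add_sub_add_comm, ← Finset.sum_sub_distrib]
    rw [← zero_add (2 * Real.pi)]
    refine Filter.Tendsto.add ?_ (tendsto_segAngle_sub h01)
    suffices h : Filter.Tendsto _ _ (nhds (∑ i ∈ Finset.range r, (0 : ℝ))) by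
      simpa only [Finset.sum_const_zero] using h
    refine tendsto_finsetSum _ fun i hi => ?_
    have hc := (continuousAt_segAngle (hother i hi)).tendsto
    have := (hc.comp (hlim 1)).sub (hc.comp (hlim (-1)))
    rw [sub_self] at this
    simpa only [Function.comp_def, one_mul, neg_one_mul] using this

/-! ### Euler's inequality -/

namespace PlaneGraph

variable {V : Type*} {G : PlaneGraph V}

/-- The excess of inflow over outflow at the vertices of `N`, for an assignment `z` of real numbers
to edges directed from `a e` to `b e`. -/
def netFlow {V E : Type*} [Fintype E] [DecidableEq V] (a b : E → V) (N : Finset V) :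
    (E → ℝ) →ₗ[ℝ] (N → ℝ) where
  toFun z v := ∑ e, z e * ((if b e = v then 1 else 0) - (if a e = v then 1 else 0))
  map_add' z z' := by
    ext v
    simp [add_mul, Finset.sum_add_distrib]
  map_smul' c z := by
    ext v
    simp [Finset.mul_sum, mul_assoc]

lemma sum_flow_mul_sub {E : Type*} [Fintype V] [Fintype E] [DecidableEq V] (a b : E → V)
    (z : E → ℝ) (L : V → ℝ)
    (h : ∀ v, ∑ e, z e * ((if b e = v then 1 else 0) - (if a e = v then 1 else 0)) = 0) :
    ∑ e, z e * (L (b e) - L (a e)) = 0 := by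
  have : ∀ e, z e * (L (b e) - L (a e))
      = ∑ v, L v * (z e * ((if b e = v then 1 else 0) - (if a e = v then 1 else 0))) := by
    intro e
    simp [mul_sub, Finset.sum_sub_distrib, mul_comm]
  simp_rw [this]
  rw [Finset.sum_comm]
  simp_rw [← Finset.mul_sum, h, mul_zero, Finset.sum_const_zero]

/-- A flow satisfying the conservation law at all non-isolated vertices but one satisfies it
everywhere. -/
lemma flow_conserved {E : Type*} [Fintype V] [Fintype E] [DecidableEq V] {a b : E → V}
    {N : Finset V} {v₀ : V} (ha : ∀ e, a e ∈ N) (hb : ∀ e, b e ∈ N) {z : E → ℝ}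
    (hz : netFlow a b (N.erase v₀) z = 0) (v : V) :
    ∑ e, z e * ((if b e = v then 1 else 0) - (if a e = v then 1 else 0)) = 0 := by
  have h1 : ∀ v ≠ v₀,
      ∑ e, z e * ((if b e = v then 1 else 0) - (if a e = v then 1 else 0)) = 0 := by
    intro v hv
    by_cases hvN : v ∈ N
    · exact congrFun hz ⟨v, Finset.mem_erase.2 ⟨hv, hvN⟩⟩
    · refine Finset.sum_eq_zero fun e _ => ?_
      rw [if_neg (fun h : b e = v => hvN (h ▸ hb e)),
        if_neg (fun h : a e = v => hvN (h ▸ ha e)), sub_zero, mul_zero]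
  by_cases hv : v = v₀
  · subst hv
    have htot : ∑ w, ∑ e, z e * ((if b e = w then 1 else 0) - (if a e = w then 1 else 0)) = 0 := by
      rw [Finset.sum_comm]
      simp [← Finset.mul_sum, Finset.sum_sub_distrib]
    rwa [Finset.sum_eq_single_of_mem v (Finset.mem_univ v) fun w _ hw => h1 w hw] at htot
  · exact h1 v hv

/-- Euler's inequality `e + 2 ≤ f + n'` for the number `n'` of non-isolated vertices. Every flow on
the edges gives a locally constant function on the complement of the drawing, its winding number,
which jumps across each edge by `2π` times the value of the flow there. So flows and
constants together embed into the real functions on the set of faces. -/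
theorem numEdges_add_two_le [Fintype V] [Finite G.faces] (hE : 1 ≤ G.numEdges) (N : Finset V)
    (hN : ∀ v, v ∈ N ↔ v ∈ G.graph.support) :
    G.numEdges + 2 ≤ Nat.card G.faces + N.card := by
  classical
  let E := G.graph.edgeSet
  have hEne : Nonempty E := by
    have : G.graph.edgeSet.Nonempty := Set.nonempty_of_ncard_ne_zero (by rw [numEdges] at hE; omega)
    exact this.to_subtype
  let a : E → V := fun e => e.1.out.1
  let b : E → V := fun e => e.1.out.2
  have hab : ∀ e : E, e.1 = s(a e, b e) := fun e => (Quot.out_eq e.1).symm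
  have hadj : ∀ e : E, G.graph.Adj (a e) (b e) := fun e => by
    have := e.2
    rwa [hab e] at this
  have ha : ∀ e, a e ∈ N := fun e => (hN _).2 ⟨b e, hadj e⟩
  have hb : ∀ e, b e ∈ N := fun e => (hN _).2 ⟨a e, (hadj e).symm⟩
  choose θ hθ hθc m hmS hma hmb ν hν hjump using
    fun e : E => (arc_isPolygonalArc e.2 (hab e)).exists_angle
  have hmV : ∀ e, m e ∉ Set.range G.pos := by
    intro e hm
    have : m e ∈ G.arc e.1 \ Set.range G.pos := by
      rw [arc_diff_range_pos e.2 (hab e)]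
      exact ⟨hmS e, by simp [hma e, hmb e]⟩
    exact this.2 hm
  obtain ⟨e₀⟩ := hEne
  set v₀ := a e₀ with hv₀
  let W : (E → ℝ) → Plane → ℝ := fun z x => ∑ e, z e * θ e x
  have hWloc : ∀ z ∈ LinearMap.ker (netFlow a b (N.erase v₀)), ∀ x₀ ∉ G.support,
      ∀ᶠ x in nhds x₀, W z x₀ = W z x := by
    intro z hz x₀ hx₀
    have hall : ∀ᶠ x in nhds x₀, ∀ e, θ e x = θ e x₀
        + (turnAngle x₀ (G.pos (b e)) x - turnAngle x₀ (G.pos (a e)) x) := by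
      rw [Filter.eventually_all]
      exact fun e => hθ e x₀ fun h => hx₀ (arc_subset_support e.2 h)
    filter_upwards [hall] with x hx
    have := sum_flow_mul_sub a b z (fun v => turnAngle x₀ (G.pos v) x)
      (flow_conserved ha hb (LinearMap.mem_ker.1 hz))
    simp only [W, hx, mul_add, Finset.sum_add_distrib, this, add_zero]
  have hWface : ∀ z ∈ LinearMap.ker (netFlow a b (N.erase v₀)), ∀ F ∈ G.faces, ∀ x ∈ F, ∀ y ∈ F,
      W z x = W z y := by
    intro z hz F hF x hx y hy
    refine (isPreconnected_of_mem_faces hF).induction₂ (fun x y => W z x = W z y)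
      (fun x₀ h0 => ?_) (fun _ _ _ _ _ _ h h' => h.trans h') (fun _ _ _ _ h => h.symm) hx hy
    exact mem_nhdsWithin_of_mem_nhds (hWloc z hz x₀ (face_subset_compl hF h0))
  -- if the winding number of `z` is constant, then `z` vanishes
  have hWconst : ∀ (z : E → ℝ) (c : ℝ), (∀ x ∉ G.support, W z x = c) → z = 0 := by
    intro z c hc
    ext e
    have hlim : ∀ d : ℝ, Filter.Tendsto (fun t : ℝ => m e + (d * t) • ν e)
        (nhdsWithin 0 (Set.Ioi 0)) (nhds (m e)) := fun d => by
      have hcont : Continuous fun t : ℝ => m e + (d * t) • ν e := by fun_prop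
      have := (hcont.tendsto 0).mono_left (nhdsWithin_le_nhds (s := Set.Ioi (0 : ℝ)))
      simpa using this
    have hmother : ∀ e', e' ≠ e → m e ∉ G.arc e'.1 := fun e' hne h =>
      hmV e (G.arc_inter_arc_subset e'.1 e'.2 e.1 e.2 (fun h => hne (Subtype.ext h)) ⟨h, hmS e⟩)
    have hoff : ∀ᶠ t : ℝ in nhdsWithin 0 (Set.Ioi 0),
        m e + t • ν e ∉ G.support ∧ m e + (-t) • ν e ∉ G.support := by
      have h1 : ∀ᶠ y in nhds (m e), y ∉ Set.range G.pos ∧ ∀ e', e' ≠ e → y ∉ G.arc e'.1 := by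
        have hV : ∀ᶠ y in nhds (m e), y ∉ Set.range G.pos :=
          (Set.finite_range _).isClosed.isOpen_compl.mem_nhds (hmV e)
        refine hV.and ?_
        rw [Filter.eventually_all]
        intro e'
        by_cases h : e' = e
        · exact Filter.Eventually.of_forall fun _ h' => absurd h h'
        · filter_upwards [(isClosed_arc e'.2).isOpen_compl.mem_nhds (hmother e' h)] with y hy _
          exact hy
      have h2 : ∀ y, y ∉ Set.range G.pos ∧ (∀ e', e' ≠ e → y ∉ G.arc e'.1) → y ∉ G.arc e.1 →
          y ∉ G.support := by
        rintro y ⟨hyV, hyE⟩ hye (h | h)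
        · exact hyV h
        · simp only [Set.mem_iUnion] at h
          obtain ⟨e', he', h⟩ := h
          by_cases hee : (⟨e', he'⟩ : E) = e
          · exact hye (by rw [← hee]; exact h)
          · exact hyE ⟨e', he'⟩ hee h
      filter_upwards [hν e, (hlim 1).eventually h1, (hlim (-1)).eventually h1] with t ht ht1 ht2
      rw [one_mul] at ht1
      rw [neg_one_mul] at ht2
      exact ⟨h2 _ ht1 ht.1, h2 _ ht2 ht.2⟩
    have hl1 : Filter.Tendsto (fun t : ℝ => W z (m e + t • ν e) - W z (m e + (-t) • ν e))
        (nhdsWithin 0 (Set.Ioi 0)) (nhds 0) := by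
      refine tendsto_const_nhds.congr' ?_
      filter_upwards [hoff] with t ht
      rw [hc _ ht.1, hc _ ht.2, sub_self]
    have hl2 : Filter.Tendsto (fun t : ℝ => W z (m e + t • ν e) - W z (m e + (-t) • ν e))
        (nhdsWithin 0 (Set.Ioi 0)) (nhds (∑ e', if e' = e then z e * (2 * Real.pi) else 0)) := by
      simp only [W, ← Finset.sum_sub_distrib, ← mul_sub]
      refine tendsto_finsetSum _ fun e' _ => ?_
      by_cases h : e' = e
      · subst h
        rw [if_pos rfl]
        exact (hjump e').const_mul _
      · rw [if_neg h]
        have hcon := (hθc e' (m e) (hmother e' h)).tendsto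
        have := ((hcon.comp (hlim 1)).sub (hcon.comp (hlim (-1)))).const_mul (z e')
        rw [sub_self, mul_zero] at this
        simpa only [Function.comp_def, one_mul, neg_one_mul] using this
    have := tendsto_nhds_unique hl1 hl2
    rw [Finset.sum_ite_eq' Finset.univ e, if_pos (Finset.mem_univ e)] at this
    have hpi := Real.two_pi_pos.ne'
    exact (mul_eq_zero.1 this.symm).resolve_right hpi
  have : Fintype G.faces := Fintype.ofFinite _
  choose pt hpt using fun F : G.faces => nonempty_of_mem_faces F.2
  let K := LinearMap.ker (netFlow a b (N.erase v₀))
  let Ψ : (K × ℝ) →ₗ[ℝ] (G.faces → ℝ) :=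
    { toFun := fun q F => W q.1.1 (pt F) + q.2
      map_add' := fun q q' => by
        ext F
        simp only [W, Prod.fst_add, Prod.snd_add, Submodule.coe_add, Pi.add_apply, add_mul,
          Finset.sum_add_distrib]
        ring
      map_smul' := fun c q => by
        ext F
        simp only [W, Prod.smul_fst, Prod.smul_snd, SetLike.val_smul, Pi.smul_apply, smul_eq_mul,
          mul_assoc, ← Finset.mul_sum, RingHom.id_apply, mul_add] }
  have hinj : Function.Injective Ψ := by
    rw [injective_iff_map_eq_zero]
    rintro ⟨⟨z, hz⟩, c⟩ h
    have hc : ∀ x ∉ G.support, W z x = -c := by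
      intro x hx
      obtain ⟨F, hF, hxF⟩ := exists_face_mem hx
      have h1 : W z (pt ⟨F, hF⟩) + c = 0 := congrFun h ⟨F, hF⟩
      rw [hWface z hz F hF x hxF _ (hpt ⟨F, hF⟩)]
      linarith
    have hz0 := hWconst z _ hc
    obtain ⟨x, hx⟩ : ∃ x, x ∉ G.support := by
      obtain ⟨t, ht⟩ : ∃ t : ℝ, m e₀ + t • ν e₀ ∉ G.arc e₀.1 := by
        obtain ⟨t, ht⟩ := (hν e₀).exists
        exact ⟨t, ht.1⟩
      by_contra! hall
      have hnhds : G.arc e₀.1 ∈ nhds (m e₀) := by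
        obtain ⟨w, r, hstar, hloc⟩ := exists_localStar_arc e₀.2 (hmS e₀) (hmV e₀)
        filter_upwards [Metric.ball_mem_nhds _ hstar.pos] with y hy
        have := (hloc (y - m e₀) (by rwa [← dist_eq_norm])).1 (hall _)
        rwa [add_sub_cancel] at this
      have hlim : Filter.Tendsto (fun t : ℝ => m e₀ + t • ν e₀)
          (nhdsWithin 0 (Set.Ioi 0)) (nhds (m e₀)) := by
        have hcont : Continuous fun t : ℝ => m e₀ + t • ν e₀ := by fun_prop
        have := (hcont.tendsto 0).mono_left (nhdsWithin_le_nhds (s := Set.Ioi (0 : ℝ)))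
        simpa using this
      obtain ⟨t, ht, ht'⟩ := ((hν e₀).and (hlim.eventually hnhds)).exists
      exact ht.1 ht'
    have hc0 := hc x hx
    have hW0 : W z x = 0 := by simp [W, hz0]
    have : c = 0 := by linarith
    subst this
    simp [hz0]
  have h1 := LinearMap.finrank_le_finrank_of_injective hinj
  have h2 := LinearMap.finrank_range_add_finrank_ker (netFlow a b (N.erase v₀))
  have h3 := (LinearMap.range (netFlow a b (N.erase v₀))).finrank_le
  have h4 : (N.erase v₀).card + 1 = N.card := Finset.card_erase_add_one (ha e₀)
  have h5 : G.numEdges = Fintype.card E := by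
    rw [numEdges, ← Nat.card_coe_set_eq, Nat.card_eq_fintype_card]
  rw [Module.finrank_prod, Module.finrank_self, Module.finrank_fintype_fun_eq_card] at h1
  rw [Module.finrank_fintype_fun_eq_card] at h2 h3
  rw [Fintype.card_coe] at h3
  rw [Nat.card_eq_fintype_card, h5]
  change Module.finrank ℝ K + 1 ≤ _ at h1
  change _ + Module.finrank ℝ K = _ at h2
  omega

end PlaneGraph

/-! ### The upper bound -/

/-- The maximal number of edges, without floors: with `n = q k + β`, there are `q` big faces which
partition the vertices, or `q + 1` big faces of length exactly `k`, whichever is better. -/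
lemma floor_sub_alphaCorrection {k n : ℕ} (hk : 4 ≤ k) :
    ⌊((2 * (k : ℝ) + 3) * (n : ℝ)) / (k : ℝ) - 6⌋ - alphaCorrection k n
      = 2 * n - 6 + 3 * (n / k : ℕ) + max 0 ((n % k : ℕ) + 3 - k : ℤ) := by
  have hk0 : (k : ℝ) ≠ 0 := by positivity
  have hkpos : (0 : ℝ) < k := by positivity
  have hn : (n : ℝ) = k * (n / k : ℕ) + (n % k : ℕ) := by exact_mod_cast (Nat.div_add_mod n k).symm
  have hlt : n % k < k := Nat.mod_lt _ (by omega)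
  have h1 : ((2 * (k : ℝ) + 3) * (n : ℝ)) / (k : ℝ) - 6
      = ((2 * n - 6 + 3 * (n / k : ℕ) : ℤ) : ℝ) + 3 * ((n % k : ℕ) : ℝ) / (k : ℝ) := by
    have : 3 * (n : ℝ) / k = 3 * (n / k : ℕ) + 3 * ((n % k : ℕ) : ℝ) / k := by
      nth_rewrite 1 [hn]
      field_simp
    simp only [Int.cast_add, Int.cast_sub, Int.cast_mul, Int.cast_natCast, Int.cast_ofNat]
    rw [add_mul, add_div, this]
    field_simp
    ring
  rw [h1, Int.floor_intCast_add]
  unfold alphaCorrection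
  split_ifs with h h'
  · have hβ : ((n % k : ℕ) : ℝ) = k - 1 := by
      rw [h, Nat.cast_sub (by omega)]
      simp
    have hk4 : (4 : ℝ) ≤ k := by exact_mod_cast hk
    have hf : ⌊3 * ((n % k : ℕ) : ℝ) / (k : ℝ)⌋ = 2 := by
      rw [Int.floor_eq_iff, hβ]
      constructor
      · rw [le_div_iff₀ hkpos]
        push_cast
        linarith
      · rw [div_lt_iff₀ hkpos]
        push_cast
        linarith
    rw [hf, max_eq_right (by omega)]
    omega
  · have hβ : ((n % k : ℕ) : ℝ) = k - 2 := by
      rw [h', Nat.cast_sub (by omega)]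
      simp
    have hf : 3 * ((n % k : ℕ) : ℝ) / (k : ℝ) = (2 - 6 / (k : ℝ)) + 1 := by
      rw [hβ]
      field_simp
      ring
    rw [hf, Int.floor_add_one, max_eq_right (by omega)]
    omega
  · rw [max_eq_left (by omega)]
    omega

namespace PlaneGraph

lemma finite_faces {V : Type*} [Fintype V] (G : PlaneGraph V) (hE : 2 ≤ G.numEdges) :
    G.faces.Finite := by
  by_contra hinf
  obtain ⟨s, hs, hcard⟩ := Set.Infinite.exists_subset_card_eq hinf (2 * G.numEdges)
  have h1 := sum_faceLength_le s fun F hF => hs hF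
  have h2 : s.card * 3 ≤ ∑ F ∈ s, G.faceLength F := by
    rw [← smul_eq_mul]
    exact Finset.card_nsmul_le_sum _ _ _ fun F hF => three_le_faceLength hE (hs hF)
  omega

theorem numEdges_le {V : Type*} [Fintype V] (G : PlaneGraph V) {k n : ℕ} (hk : 4 ≤ k) (hn : k ≤ n)
    (hV : Fintype.card V = n) (hG : G.EveryVertexBoundsGon k) :
    (G.numEdges : ℤ) ≤ 2 * n - 6 + 3 * (n / k : ℕ) + max 0 ((n % k : ℕ) + 3 - k : ℤ) := by
  classical
  have hq : 1 ≤ n / k := (Nat.one_le_div_iff (by omega)).2 hn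
  have hle0 := le_max_left 0 ((n % k : ℕ) + 3 - k : ℤ)
  have hle1 := le_max_right 0 ((n % k : ℕ) + 3 - k : ℤ)
  by_cases hE : G.numEdges < 2
  · omega
  rw [not_lt] at hE
  have hfin := G.finite_faces hE
  have : Finite G.faces := hfin.to_subtype
  set 𝓕 := hfin.toFinset with h𝓕
  have hmem : ∀ F, F ∈ 𝓕 ↔ F ∈ G.faces := fun F => by simp [h𝓕]
  set N : Finset V := Finset.univ.filter (· ∈ G.graph.support) with hN
  have heuler := numEdges_add_two_le (G := G) (by omega) N (by simp [hN])
  have hcard : Nat.card G.faces = 𝓕.card := by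
    rw [Nat.card_coe_set_eq, Set.ncard_eq_toFinset_card _ hfin]
  set T := 𝓕.filter (fun F => k ≤ G.faceLength F) with hT
  have hsum := sum_faceLength_le 𝓕 fun F hF => (hmem F).1 hF
  set T' := 𝓕.filter (fun F => ¬ k ≤ G.faceLength F) with hT'
  rw [← Finset.sum_filter_add_sum_filter_not 𝓕 (fun F => k ≤ G.faceLength F), ← hT, ← hT'] at hsum
  have hsplit : T.card + T'.card = 𝓕.card :=
    Finset.card_filter_add_card_filter_not (s := 𝓕) (fun F => k ≤ G.faceLength F)
  have hsmall : T'.card * 3 ≤ ∑ F ∈ T', G.faceLength F := by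
    rw [← smul_eq_mul]
    exact Finset.card_nsmul_le_sum _ _ _ fun F hF =>
      three_le_faceLength hE ((hmem F).1 (Finset.mem_filter.1 hF).1)
  have hbig : T.card * k ≤ ∑ F ∈ T, G.faceLength F := by
    rw [← smul_eq_mul]
    exact Finset.card_nsmul_le_sum _ _ _ fun F hF => (Finset.mem_filter.1 hF).2
  have hcover : N.card ≤ ∑ F ∈ T, G.faceLength F := by
    have hsub : N ⊆ T.biUnion fun F => N.filter fun v => G.pos v ∈ closure F := by
      intro v hv
      obtain ⟨F, hF, hkF, hvF⟩ := hG v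
      rw [frontier_face hF] at hvF
      exact Finset.mem_biUnion.2 ⟨F, Finset.mem_filter.2 ⟨(hmem F).2 hF, hkF⟩,
        Finset.mem_filter.2 ⟨hv, hvF.1⟩⟩
    refine (Finset.card_le_card hsub).trans (Finset.card_biUnion_le.trans
      (Finset.sum_le_sum fun F hF => ?_))
    refine card_le_faceLength ((hmem F).1 (Finset.mem_filter.1 hF).1) _ fun v hv => ?_
    obtain ⟨h1, h2⟩ := Finset.mem_filter.1 hv
    exact ⟨(Finset.mem_filter.1 h1).2, h2⟩
  have hNn : N.card ≤ n := by
    rw [← hV]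
    exact Finset.card_le_univ N
  have hdiv := Nat.div_add_mod n k
  rw [hcard] at heuler
  rcases le_or_gt T.card (n / k) with ht | ht
  · omega
  · have h1 : ((k : ℤ) - 3) * (n / k : ℕ) + (k - 3) ≤ (T.card : ℤ) * k - 3 * T.card := by
      have h2 : ((n / k : ℕ) : ℤ) + 1 ≤ T.card := by exact_mod_cast ht
      have h3 : (0 : ℤ) ≤ (k : ℤ) - 3 := by omega
      nlinarith [mul_le_mul_of_nonneg_left h2 h3]
    have hdiv' : (k : ℤ) * (n / k : ℕ) + (n % k : ℕ) = n := by exact_mod_cast hdiv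
    have hbig' : (T.card : ℤ) * k ≤ (∑ F ∈ T, G.faceLength F : ℕ) := by exact_mod_cast hbig
    rw [sub_mul] at h1
    omega

end PlaneGraph

/-! ### Straight-line plane graphs -/

lemma isPolygonalArc_segment {a b : Plane} (h : a ≠ b) : IsPolygonalArc a b (segment ℝ a b) := by
  refine ⟨0, fun i => if i = 0 then a else b, by simp, by simp, ?_, by simp, ?_, by simp⟩
  · intro i hi
    obtain rfl : i = 0 := by omega
    simpa using h
  · intro i j hij hj
    omega

/-- The straight-line drawing of a graph, given that edges meet in vertices only. -/
noncomputable def PlaneGraph.ofSegments {V : Type*} (H : SimpleGraph V) (pos : V → Plane)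
    (hpos : Function.Injective pos)
    (hvert : ∀ u v w, H.Adj u v → pos w ∈ segment ℝ (pos u) (pos v) → w = u ∨ w = v)
    (hedge : ∀ u v u' v', H.Adj u v → H.Adj u' v' → s(u, v) ≠ s(u', v') →
      segment ℝ (pos u) (pos v) ∩ segment ℝ (pos u') (pos v') ⊆ Set.range pos) : PlaneGraph V where
  graph := H
  pos := pos
  arc := Sym2.lift ⟨fun u v => segment ℝ (pos u) (pos v), fun u v => segment_symm ℝ _ _⟩
  pos_injective := hpos
  isPolygonalArc u v huv := isPolygonalArc_segment (hpos.ne (H.ne_of_adj huv))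
  mem_of_pos_mem_arc e he w hw := by
    induction e using Sym2.ind with
    | _ u v => exact Sym2.mem_iff.2 (hvert u v w he hw)
  arc_inter_arc_subset e he e' he' hne := by
    induction e using Sym2.ind with
    | _ u v =>
      induction e' using Sym2.ind with
      | _ u' v' => exact hedge u v u' v' he he' hne

lemma affine_nonpos_of_mem_segment {α β γ : ℝ} {P Q z : Plane} (hz : z ∈ segment ℝ P Q)
    (hP : α * P 0 + β * P 1 + γ ≤ 0) (hQ : α * Q 0 + β * Q 1 + γ ≤ 0) :
    α * z 0 + β * z 1 + γ ≤ 0 := by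
  obtain ⟨s, t, hs, ht, hst, rfl⟩ := hz
  simp only [PiLp.add_apply, PiLp.smul_apply, smul_eq_mul]
  obtain rfl : s = 1 - t := by linarith
  linarith [mul_nonpos_of_nonneg_of_nonpos hs hP, mul_nonpos_of_nonneg_of_nonpos ht hQ]

/-- If every vertex of `s` can be seen from the point `c`, then all of them lie on the boundary of
the face containing `c`, which therefore is long. -/
lemma PlaneGraph.exists_face_of_visible {V : Type*} [Fintype V] (G : PlaneGraph V) (c : Plane)
    (s : Finset V) (hs : s.Nonempty) (hsupp : ∀ v ∈ s, v ∈ G.graph.support)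
    (hvis : ∀ v ∈ s, ∀ t : ℝ, 0 ≤ t → t < 1 → c + t • (G.pos v - c) ∉ G.support) :
    ∃ F ∈ G.faces, s.card ≤ G.faceLength F ∧ ∀ v ∈ s, G.pos v ∈ frontier F := by
  have hc : c ∉ G.support := by
    obtain ⟨v, hv⟩ := hs
    simpa using hvis v hv 0 le_rfl zero_lt_one
  obtain ⟨F, hF, hcF⟩ := exists_face_mem hc
  have hcl : ∀ v ∈ s, G.pos v ∈ closure F := by
    intro v hv
    have hK : (fun t : ℝ => c + t • (G.pos v - c)) '' Set.Ico 0 1 ⊆ F := by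
      refine subset_face hF (isPreconnected_Ico.image _ (Continuous.continuousOn (by fun_prop)))
        ?_ ⟨c, ⟨0, by simp, by simp⟩, hcF⟩
      rintro _ ⟨t, ht, rfl⟩
      exact hvis v hv t ht.1 ht.2
    have hlim : Filter.Tendsto (fun t : ℝ => c + t • (G.pos v - c))
        (nhdsWithin 1 (Set.Iio 1)) (nhds (G.pos v)) := by
      have hcont : Continuous fun t : ℝ => c + t • (G.pos v - c) := by fun_prop
      have := (hcont.tendsto 1).mono_left (nhdsWithin_le_nhds (s := Set.Iio (1 : ℝ)))
      simpa using this
    refine mem_closure_of_tendsto hlim ?_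
    filter_upwards [Ico_mem_nhdsLT (zero_lt_one' ℝ)] with t ht
    exact hK ⟨t, ht, rfl⟩
  refine ⟨F, hF, card_le_faceLength hF s fun v hv => ⟨hsupp v hv, hcl v hv⟩, fun v hv => ?_⟩
  rw [frontier_face hF]
  exact ⟨hcl v hv, pos_mem_support v⟩

/-- In a straight-line drawing without isolated vertices, the vertices of `s` are on the boundary of
one long face if each of them and each edge can be separated by a line which strictly separates
a fixed point `c` from the edge. -/
lemma PlaneGraph.exists_face_of_separated {V : Type*} [Fintype V] (H : SimpleGraph V)
    (pos : V → Plane) (hpos hvert hedge) (hH : ∀ v, v ∈ H.support) (c : Plane) (s : Finset V)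
    (hs : s.Nonempty)
    (hsep : ∀ v ∈ s, ∀ u u', H.Adj u u' → ∃ α β γ : ℝ, 0 < α * c 0 + β * c 1 + γ ∧
      0 ≤ α * pos v 0 + β * pos v 1 + γ ∧ α * pos u 0 + β * pos u 1 + γ ≤ 0 ∧
      α * pos u' 0 + β * pos u' 1 + γ ≤ 0) :
    ∃ F ∈ (PlaneGraph.ofSegments H pos hpos hvert hedge).faces,
      s.card ≤ (PlaneGraph.ofSegments H pos hpos hvert hedge).faceLength F ∧
      ∀ v ∈ s, pos v ∈ frontier F := by
  refine PlaneGraph.exists_face_of_visible (PlaneGraph.ofSegments H pos hpos hvert hedge) c s hs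
    (fun v _ => hH v) ?_
  intro v hv t ht0 ht1 hmem
  have hedge' : ∀ u u', H.Adj u u' → c + t • (pos v - c) ∉ segment ℝ (pos u) (pos u') := by
    intro u u' huu' hz
    obtain ⟨α, β, γ, h1, h2, h3, h4⟩ := hsep v hv u u' huu'
    have := affine_nonpos_of_mem_segment hz h3 h4
    simp only [PiLp.add_apply, PiLp.smul_apply, PiLp.sub_apply, smul_eq_mul] at this
    nlinarith [mul_nonneg ht0 h2, mul_pos (sub_pos.2 ht1) h1]
  rcases hmem with ⟨u, hu⟩ | hmem
  · obtain ⟨u', hu'⟩ := hH u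
    refine hedge' u u' hu' ?_
    have hu : pos u = c + t • (pos v - c) := hu
    rw [← hu]
    exact left_mem_segment ℝ _ _
  · simp only [Set.mem_iUnion] at hmem
    obtain ⟨e, he, hmem⟩ := hmem
    induction e using Sym2.ind with
    | _ u u' => exact hedge' u u' he hmem

/-! ### Points on a parabola and an apex below it -/

/-- The point `(i, i²)` of the parabola for `i ≤ m`, and a point far below the origin for
`i = m + 1`. -/
noncomputable def parabolaPt (m i : ℕ) : Plane :=
  if i = m + 1 then !₂[0, -(3 * ((m : ℝ) + 2) ^ 2)] else !₂[(i : ℝ), (i : ℝ) ^ 2]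

lemma parabolaPt_zero {m i : ℕ} (h : i ≤ m) : parabolaPt m i 0 = i := by
  simp [parabolaPt, show i ≠ m + 1 by omega]

lemma parabolaPt_one {m i : ℕ} (h : i ≤ m) : parabolaPt m i 1 = (i : ℝ) ^ 2 := by
  simp [parabolaPt, show i ≠ m + 1 by omega]

lemma parabolaPt_apex_zero (m : ℕ) : parabolaPt m (m + 1) 0 = 0 := by
  simp [parabolaPt]

lemma parabolaPt_apex_one (m : ℕ) : parabolaPt m (m + 1) 1 = -(3 * ((m : ℝ) + 2) ^ 2) := by
  simp [parabolaPt]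

lemma plane_ext {z w : Plane} (h0 : z 0 = w 0) (h1 : z 1 = w 1) : z = w := by
  ext i
  fin_cases i
  · exact h0
  · exact h1

lemma eq_parabolaPt {m i : ℕ} (h : i ≤ m) {z : Plane} (h0 : z 0 = i) (h1 : z 1 = (i : ℝ) ^ 2) :
    z = parabolaPt m i :=
  plane_ext (h0.trans (parabolaPt_zero h).symm) (h1.trans (parabolaPt_one h).symm)

lemma parabolaPt_injOn (m : ℕ) {i j : ℕ} (hi : i ≤ m + 1) (hj : j ≤ m + 1)
    (h : parabolaPt m i = parabolaPt m j) : i = j := by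
  have hneg : ∀ i, i ≤ m → parabolaPt m i ≠ parabolaPt m (m + 1) := by
    intro i hi h
    have := congrArg (fun z : Plane => z 1) h
    simp only [parabolaPt_one hi, parabolaPt_apex_one] at this
    have h1 : (0 : ℝ) < 3 * ((m : ℝ) + 2) ^ 2 := by positivity
    nlinarith [sq_nonneg (i : ℝ)]
  rcases Nat.lt_or_ge i (m + 1) with hi' | hi' <;> rcases Nat.lt_or_ge j (m + 1) with hj' | hj'
  · have := congrArg (fun z : Plane => z 0) h
    simp only [parabolaPt_zero (show i ≤ m by omega), parabolaPt_zero (show j ≤ m by omega)] at this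
    exact_mod_cast this
  · obtain rfl : j = m + 1 := by omega
    exact absurd h (hneg i (by omega))
  · obtain rfl : i = m + 1 := by omega
    exact absurd h.symm (hneg j (by omega))
  · omega

lemma chord_mem {m i j : ℕ} (hi : i ≤ m) (hj : j ≤ m) (hij : i < j) {z : Plane}
    (hz : z ∈ segment ℝ (parabolaPt m i) (parabolaPt m j)) :
    (i : ℝ) ≤ z 0 ∧ z 0 ≤ j ∧ z 1 = (i + j) * z 0 - i * j := by
  obtain ⟨s, t, hs, ht, hst, rfl⟩ := hz
  have hij' : (i : ℝ) < j := by exact_mod_cast hij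
  simp only [PiLp.add_apply, PiLp.smul_apply, smul_eq_mul, parabolaPt_zero hi, parabolaPt_zero hj,
    parabolaPt_one hi, parabolaPt_one hj]
  obtain rfl : s = 1 - t := by linarith
  refine ⟨?_, ?_, ?_⟩
  · nlinarith
  · nlinarith
  · ring

lemma apex_mem {m i : ℕ} (hi : i ≤ m) {z : Plane}
    (hz : z ∈ segment ℝ (parabolaPt m i) (parabolaPt m (m + 1))) :
    ∃ s : ℝ, 0 ≤ s ∧ s ≤ 1 ∧ z 0 = s * i ∧
      z 1 = -(3 * ((m : ℝ) + 2) ^ 2) + s * ((i : ℝ) ^ 2 + 3 * ((m : ℝ) + 2) ^ 2) := by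
  obtain ⟨s, t, hs, ht, hst, rfl⟩ := hz
  refine ⟨s, hs, by linarith, ?_, ?_⟩
  · simp [parabolaPt_zero hi, parabolaPt_apex_zero]
  · simp only [PiLp.add_apply, PiLp.smul_apply, smul_eq_mul, parabolaPt_one hi, parabolaPt_apex_one]
    obtain rfl : t = 1 - s := by linarith
    ring

lemma mul_lt_apex {m i j : ℕ} (hi : i ≤ m) (hj : j ≤ m + 1) :
    (i : ℝ) * j < ((m : ℝ) + 2) ^ 2 := by
  have h1 : (i : ℝ) ≤ m := by exact_mod_cast hi
  have h2 : (j : ℝ) ≤ m + 1 := by exact_mod_cast hj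
  have h3 := Nat.cast_nonneg (α := ℝ) i
  have h4 := Nat.cast_nonneg (α := ℝ) m
  nlinarith [mul_le_mul h1 h2 (Nat.cast_nonneg j) h4]

/-- A point of a segment to the apex is strictly below the parabola unless it is the upper end. -/
lemma apex_below {m i : ℕ} (hi : i ≤ m) {z : Plane}
    (hz : z ∈ segment ℝ (parabolaPt m i) (parabolaPt m (m + 1))) (h : z 0 ^ 2 ≤ z 1) :
    z = parabolaPt m i := by
  obtain ⟨s, hs, hs1, h0, h1⟩ := apex_mem hi hz
  have hM := mul_lt_apex hi (show i ≤ m + 1 by omega)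
  have hs' : s = 1 := by
    by_contra hne
    have hlt : 0 < 1 - s := sub_pos.2 (lt_of_le_of_ne hs1 hne)
    rw [h0, h1] at h
    have h3 : 0 < 3 * ((m : ℝ) + 2) ^ 2 - s * (i : ℝ) ^ 2 := by
      nlinarith [mul_le_mul_of_nonneg_right hs1 (sq_nonneg (i : ℝ)), sq_nonneg ((m : ℝ) + 2)]
    nlinarith [mul_pos hlt h3]
  subst hs'
  refine eq_parabolaPt hi ?_ ?_
  · rw [h0, one_mul]
  · rw [h1]; ring

lemma chord_above {m i j : ℕ} (hi : i ≤ m) (hj : j ≤ m) (hij : i < j) {z : Plane}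
    (hz : z ∈ segment ℝ (parabolaPt m i) (parabolaPt m j)) : z 0 ^ 2 ≤ z 1 := by
  obtain ⟨h1, h2, h3⟩ := chord_mem hi hj hij hz
  rw [h3]
  nlinarith [mul_nonneg (sub_nonneg.2 h1) (sub_nonneg.2 h2)]

lemma chord_end {m i j : ℕ} (hi : i ≤ m) (hj : j ≤ m) (hij : i < j) {z : Plane}
    (hz : z ∈ segment ℝ (parabolaPt m i) (parabolaPt m j)) (h : (z 0 - i) * (j - z 0) = 0) :
    z = parabolaPt m i ∨ z = parabolaPt m j := by
  obtain ⟨h1, h2, h3⟩ := chord_mem hi hj hij hz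
  rcases mul_eq_zero.1 h with h | h
  · left
    have h0 : z 0 = i := by linarith
    exact eq_parabolaPt hi h0 (by rw [h3, h0]; ring)
  · right
    have h0 : z 0 = j := by linarith
    exact eq_parabolaPt hj h0 (by rw [h3, h0]; ring)

/-- Two chords of the parabola whose ends do not interlace meet in common ends only. -/
lemma chord_inter_chord {m i j i' j' : ℕ} (hj : j ≤ m) (hij : i < j) (hj' : j' ≤ m) (hij' : i' < j')
    (hne : i ≠ i' ∨ j ≠ j') (h1 : ¬(i < i' ∧ i' < j ∧ j < j')) (h2 : ¬(i' < i ∧ i < j' ∧ j' < j))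
    {z : Plane} (hz : z ∈ segment ℝ (parabolaPt m i) (parabolaPt m j))
    (hz' : z ∈ segment ℝ (parabolaPt m i') (parabolaPt m j')) :
    z = parabolaPt m i ∨ z = parabolaPt m j := by
  have hi : i ≤ m := by omega
  have hi' : i' ≤ m := by omega
  obtain ⟨a1, a2, a3⟩ := chord_mem hi hj hij hz
  obtain ⟨b1, b2, b3⟩ := chord_mem hi' hj' hij' hz'
  have hpar : (z 0 - i) * (j - z 0) = (z 0 - i') * (j' - z 0) := by
    rw [a3] at b3
    linear_combination b3
  have hnest : ∀ i j i' j' : ℕ, i ≤ i' → j' ≤ j → (i ≠ i' ∨ j ≠ j') →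
      (i' : ℝ) ≤ z 0 → z 0 ≤ j' → (z 0 - i) * (j - z 0) = (z 0 - i') * (j' - z 0) →
      (z 0 - i) * (j - z 0) = 0 := by
    intro i j i' j' hi hj hne h1 h2 h
    rcases Nat.lt_or_ge i i' with hlt | hge
    · have e1 : (i : ℝ) < i' := by exact_mod_cast hlt
      have e2 : (j' : ℝ) ≤ j := by exact_mod_cast hj
      have e3 : (z 0 - i') * (j' - z 0) ≤ (z 0 - i') * (j - z 0) :=
        mul_le_mul_of_nonneg_left (by linarith) (by linarith)
      have e4 : ((i' : ℝ) - i) * (j - z 0) ≤ 0 := by nlinarith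
      have e5 : (j : ℝ) - z 0 = 0 := by nlinarith
      rw [e5, mul_zero]
    · obtain rfl : i = i' := by omega
      have hlt : j' < j := by omega
      have e1 : (j' : ℝ) < j := by exact_mod_cast hlt
      have e2 : (z 0 - i) * ((j : ℝ) - j') = 0 := by linear_combination h
      have e3 : z 0 - i = 0 := (mul_eq_zero.1 e2).resolve_right (by linarith)
      rw [e3, zero_mul]
  apply chord_end hi hj hij hz
  rcases (by omega : j ≤ i' ∨ j' ≤ i ∨ (i ≤ i' ∧ j' ≤ j) ∨ (i' ≤ i ∧ j ≤ j')) with h | h | h | h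
  · have : (j : ℝ) ≤ i' := by exact_mod_cast h
    rw [show (j : ℝ) - z 0 = 0 by linarith, mul_zero]
  · have : (j' : ℝ) ≤ i := by exact_mod_cast h
    rw [show z 0 - (i : ℝ) = 0 by linarith, zero_mul]
  · exact hnest i j i' j' h.1 h.2 hne b1 b2 hpar
  · rw [hpar]
    exact hnest i' j' i j h.1 h.2 (hne.imp Ne.symm Ne.symm) a1 a2 hpar.symm

lemma apex_inter_apex {m i i' : ℕ} (hi : i ≤ m) (hi' : i' ≤ m) (hne : i ≠ i') {z : Plane}
    (hz : z ∈ segment ℝ (parabolaPt m i) (parabolaPt m (m + 1)))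
    (hz' : z ∈ segment ℝ (parabolaPt m i') (parabolaPt m (m + 1))) :
    z = parabolaPt m (m + 1) := by
  obtain ⟨s, hs, hs1, h0, h1⟩ := apex_mem hi hz
  obtain ⟨t, ht, ht1, k0, k1⟩ := apex_mem hi' hz'
  have hM := mul_lt_apex hi (show i' ≤ m + 1 by omega)
  set M := 3 * ((m : ℝ) + 2) ^ 2 with hMdef
  have hMpos : 0 < M := by positivity
  have e1 : s * i = t * i' := h0.symm.trans k0
  have e2 : s * ((i : ℝ) ^ 2 + M) = t * ((i' : ℝ) ^ 2 + M) := by linarith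
  -- the direction `(i, i² + M)` determines `i` as long as `i i' ≠ M`
  have e3 : s * (((i' : ℝ) - i) * (M - i * i')) = 0 := by
    linear_combination i' * e2 - ((i' : ℝ) ^ 2 + M) * e1
  have hii : ((i' : ℝ) - i) ≠ 0 := by
    rw [sub_ne_zero]
    exact_mod_cast hne.symm
  have hMi : M - i * i' ≠ 0 := by nlinarith [sq_nonneg ((m : ℝ) + 2)]
  have hs0 : s = 0 := (mul_eq_zero.1 e3).resolve_right (mul_ne_zero hii hMi)
  refine plane_ext ?_ ?_
  · rw [h0, hs0, zero_mul, parabolaPt_apex_zero]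
  · rw [h1, hs0, zero_mul, add_zero, parabolaPt_apex_one]

/-! ### The extremal graphs -/

/-- Adjacency `i < j` among the points of the parabola in the extremal graph: the path
`0, 1, …, b + r k`, the chords cutting off the `r` blocks of `k` consecutive points which start at
`b + 1`, and all edges from `0` except those into the interior of a block. -/
def hullAdj (k b r i j : ℕ) : Prop :=
  (j = i + 1 ∧ j ≤ b + r * k) ∨
  (i = 0 ∧ 0 < j ∧ j ≤ b + r * k ∧ ∀ g < r, ¬(b + 1 + g * k < j ∧ j < b + g * k + k)) ∨
  (∃ g < r, i = b + 1 + g * k ∧ j = b + g * k + k)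

/-- The points of the parabola joined to the apex: all but those strictly between `0` and `l` and
those strictly between `a` and `b`. -/
def apexAdj (k l a b r i : ℕ) : Prop :=
  i ≤ b + r * k ∧ ¬(0 < i ∧ i < l) ∧ ¬(a < i ∧ i < b)

/-- The extremal graph: `b + r k + 1` points of a parabola and the apex, which is the last vertex.
The big faces are the two gaps at the apex and the `r` blocks. -/
def stackGraph (k l a b r : ℕ) : SimpleGraph (Fin (b + r * k + 2)) :=
  SimpleGraph.fromRel fun u v => hullAdj k b r u v ∨ (v.1 = b + r * k + 1 ∧ apexAdj k l a b r u)

section Adjacency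

variable {k l a b r : ℕ}

lemma block_le {g r k : ℕ} (hg : g < r) : g * k + k ≤ r * k := by
  have := Nat.mul_le_mul_right k hg
  rwa [Nat.succ_mul] at this

lemma hullAdj.lt (hk : 4 ≤ k) {i j : ℕ} (h : hullAdj k b r i j) : i < j := by
  rcases h with h | h | ⟨g, -, h⟩ <;> omega

lemma hullAdj.le {i j : ℕ} (h : hullAdj k b r i j) : j ≤ b + r * k := by
  rcases h with h | h | ⟨g, hg, h⟩
  · omega
  · omega
  · have := block_le (k := k) hg
    omega

lemma hullAdj.not_interlace {i j i' j' : ℕ} (h : hullAdj k b r i j)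
    (h' : hullAdj k b r i' j') : ¬(i < i' ∧ i' < j ∧ j < j') := by
  rintro ⟨h1, h2, h3⟩
  rcases h' with h' | h' | ⟨g', hg', h'⟩
  · omega
  · omega
  · rcases h with h | h | ⟨g, hg, h⟩
    · omega
    · exact h.2.2.2 g' hg' (by omega)
    · rcases lt_trichotomy g g' with hgg | rfl | hgg
      · have := block_le (k := k) hgg
        omega
      · omega
      · have := block_le (k := k) hgg
        omega

/-- An edge of the hull is on the other side of the chord of a block, or on the path along the
block. -/
lemma hullAdj.outside_or_path {i j g : ℕ} (hg : g < r) (h : hullAdj k b r i j) :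
    ((i ≤ b + 1 + g * k ∨ b + g * k + k ≤ i) ∧ (j ≤ b + 1 + g * k ∨ b + g * k + k ≤ j)) ∨
      (j = i + 1 ∧ b + 1 + g * k ≤ i ∧ j ≤ b + g * k + k) := by
  rcases h with h | h | ⟨g', hg', h⟩
  · omega
  · have := h.2.2.2 g hg
    omega
  · rcases lt_trichotomy g g' with hgg | rfl | hgg
    · have := block_le (k := k) hgg
      omega
    · omega
    · have := block_le (k := k) hgg
      omega

lemma stackGraph_adj (hk : 4 ≤ k) {u v : Fin (b + r * k + 2)} (huv : u.1 < v.1) :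
    (stackGraph k l a b r).Adj u v ↔
      hullAdj k b r u v ∨ (v.1 = b + r * k + 1 ∧ apexAdj k l a b r u) := by
  rw [stackGraph, SimpleGraph.fromRel_adj]
  constructor
  · rintro ⟨-, h | h | h⟩
    · exact h
    · exact absurd (h.lt hk) (by omega)
    · have := h.2.1
      omega
  · exact fun h => ⟨fun h' => by rw [h'] at huv; exact lt_irrefl _ huv, Or.inl h⟩

lemma stackGraph_mem_support (hk : 4 ≤ k) (v : Fin (b + r * k + 2)) :
    v ∈ (stackGraph k l a b r).support := by
  have h0 : ∀ x y : Fin (b + r * k + 2), x.1 = 0 → y.1 = b + r * k + 1 →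
      (stackGraph k l a b r).Adj x y := fun x y hx hy =>
    (stackGraph_adj hk (by omega)).2 (Or.inr ⟨hy, by simp [apexAdj, hx]⟩)
  rw [SimpleGraph.mem_support]
  rcases Nat.lt_or_ge v.1 (b + r * k + 1) with hv | hv
  · rcases Nat.eq_zero_or_pos v.1 with h | h
    · exact ⟨⟨b + r * k + 1, Nat.lt_succ_self _⟩, h0 _ _ h rfl⟩
    · refine ⟨⟨v.1 - 1, by omega⟩, SimpleGraph.Adj.symm ?_⟩
      have hlt : v.1 - 1 < v.1 := by omega
      exact (stackGraph_adj hk hlt).2 (Or.inl (Or.inl ⟨by simp only; omega, by omega⟩))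
  · exact ⟨⟨0, Nat.succ_pos _⟩, (h0 _ _ rfl (by omega)).symm⟩

/-- The position of a vertex of the extremal graph. -/
noncomputable def stackPos (k b r : ℕ) (v : Fin (b + r * k + 2)) : Plane :=
  parabolaPt (b + r * k) v

lemma stackPos_injective : Function.Injective (stackPos k b r) := fun u v h =>
  Fin.ext (parabolaPt_injOn _ (by omega) (by omega) h)

lemma stackGraph_vert (hk : 4 ≤ k) (u v w : Fin (b + r * k + 2))
    (huv : (stackGraph k l a b r).Adj u v)
    (hw : stackPos k b r w ∈ segment ℝ (stackPos k b r u) (stackPos k b r v)) : w = u ∨ w = v := by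
  wlog hlt : u.1 < v.1 generalizing u v
  · have hne : u.1 ≠ v.1 := fun h => huv.ne (Fin.ext h)
    rw [segment_symm] at hw
    exact (this v u huv.symm hw (by omega)).symm
  rw [stackGraph_adj hk hlt] at huv
  have hfin : ∀ x y : Fin (b + r * k + 2), stackPos k b r x = stackPos k b r y → x = y :=
    fun x y h => stackPos_injective h
  rcases huv with h | ⟨hv, h⟩
  · have hj := h.le
    have hi : u.1 ≤ b + r * k := by omega
    have hab := chord_above hi hj hlt hw
    obtain ⟨h1, h2, h3⟩ := chord_mem hi hj hlt hw
    rcases Nat.lt_or_ge w.1 (b + r * k + 1) with hwm | hwm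
    · refine (chord_end hi hj hlt hw ?_).imp (hfin w u) (hfin w v)
      have e0 : stackPos k b r w 0 = w := parabolaPt_zero (by omega)
      have e1 : stackPos k b r w 1 = (w : ℝ) ^ 2 := parabolaPt_one (by omega)
      rw [e0, e1] at h3
      rw [e0]
      linear_combination -h3
    · exfalso
      have hwe : w.1 = b + r * k + 1 := by omega
      have e0 : stackPos k b r w 0 = 0 := by
        rw [stackPos, hwe, parabolaPt_apex_zero]
      have e1 : stackPos k b r w 1 = -(3 * (((b + r * k : ℕ) : ℝ) + 2) ^ 2) := by
        rw [stackPos, hwe, parabolaPt_apex_one]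
      rw [e0, e1] at hab
      have : (0 : ℝ) < 3 * (((b + r * k : ℕ) : ℝ) + 2) ^ 2 := by positivity
      linarith
  · have hi : u.1 ≤ b + r * k := h.1
    rcases Nat.lt_or_ge w.1 (b + r * k + 1) with hwm | hwm
    · left
      refine hfin w u (apex_below hi (by simpa only [stackPos, hv] using hw) ?_)
      have e0 : stackPos k b r w 0 = w := parabolaPt_zero (by omega)
      have e1 : stackPos k b r w 1 = (w : ℝ) ^ 2 := parabolaPt_one (by omega)
      rw [e0, e1]
    · right
      exact Fin.ext (by omega)

lemma stackGraph_edge (hk : 4 ≤ k) (u v u' v' : Fin (b + r * k + 2))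
    (huv : (stackGraph k l a b r).Adj u v) (huv' : (stackGraph k l a b r).Adj u' v')
    (hne : s(u, v) ≠ s(u', v')) :
    segment ℝ (stackPos k b r u) (stackPos k b r v) ∩
      segment ℝ (stackPos k b r u') (stackPos k b r v') ⊆ Set.range (stackPos k b r) := by
  wlog hlt : u.1 < v.1 generalizing u v
  · have hne' : u.1 ≠ v.1 := fun h => huv.ne (Fin.ext h)
    rw [segment_symm]
    exact this v u huv.symm (by rwa [Sym2.eq_swap]) (by omega)
  wlog hlt' : u'.1 < v'.1 generalizing u' v'
  · have hne' : u'.1 ≠ v'.1 := fun h => huv'.ne (Fin.ext h)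
    rw [segment_symm ℝ (stackPos k b r u')]
    exact this v' u' huv'.symm (by rwa [Sym2.eq_swap (a := v')]) (by omega)
  rw [stackGraph_adj hk hlt] at huv
  rw [stackGraph_adj hk hlt'] at huv'
  rintro z ⟨hz, hz'⟩
  have hne' : u.1 ≠ u'.1 ∨ v.1 ≠ v'.1 := by
    by_contra! hc
    exact hne (by rw [Fin.ext hc.1, Fin.ext hc.2])
  rcases huv with h | ⟨hv, h⟩ <;> rcases huv' with h' | ⟨hv', h'⟩
  · rcases chord_inter_chord h.le hlt h'.le hlt' hne' (h.not_interlace h')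
      (h'.not_interlace h) hz hz' with h | h
    · exact ⟨u, h.symm⟩
    · exact ⟨v, h.symm⟩
  · have hj := h.le
    exact ⟨u', (apex_below h'.1 (by simpa only [stackPos, hv'] using hz')
      (chord_above (by omega) hj hlt hz)).symm⟩
  · have hj := h'.le
    exact ⟨u, (apex_below h.1 (by simpa only [stackPos, hv] using hz)
      (chord_above (by omega) hj hlt' hz')).symm⟩
  · refine ⟨v, ?_⟩
    have := apex_inter_apex h.1 h'.1 (by omega) (z := z) (by simpa only [stackPos, hv] using hz)
      (by simpa only [stackPos, hv'] using hz')
    rw [this, stackPos, hv]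

/-- The extremal plane graph. -/
noncomputable def stackPlaneGraph (k l a b r : ℕ) (hk : 4 ≤ k) :
    PlaneGraph (Fin (b + r * k + 2)) :=
  PlaneGraph.ofSegments (stackGraph k l a b r) (stackPos k b r) stackPos_injective
    (stackGraph_vert hk) (stackGraph_edge hk)

end Adjacency

/-! ### The big faces of the extremal graphs -/

lemma mul_pred_nonneg (i t : ℕ) : 0 ≤ ((i : ℝ) - t) * (i - t - 1) := by
  rcases Nat.lt_or_ge t i with h | h
  · have h1 : (t : ℝ) + 1 ≤ i := by exact_mod_cast h
    exact mul_nonneg (by linarith) (by linarith)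
  · have h1 : (i : ℝ) ≤ t := by exact_mod_cast h
    exact mul_nonneg_of_nonpos_of_nonpos (by linarith) (by linarith)

lemma mul_apex_sub_nonneg {m i j w : ℕ} (hi : i ≤ w) (hw : w ≤ m) (hj : j ≤ m) :
    0 ≤ ((w : ℝ) - i) * (3 * ((m : ℝ) + 2) ^ 2 - j * w) ∧
      0 ≤ ((w : ℝ) - i) * (3 * ((m : ℝ) + 2) ^ 2 - j * i) := by
  have h1 : (i : ℝ) ≤ w := by exact_mod_cast hi
  have h2 := mul_lt_apex hj (show w ≤ m + 1 by omega)
  have h3 := mul_lt_apex hj (show i ≤ m + 1 by omega)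
  have h4 := sq_nonneg ((m : ℝ) + 2)
  exact ⟨mul_nonneg (by linarith) (by linarith), mul_nonneg (by linarith) (by linarith)⟩

section BigFaces

variable {k l a b r : ℕ}

lemma stackPos_zero {v : Fin (b + r * k + 2)} (h : v.1 ≤ b + r * k) : stackPos k b r v 0 = v.1 :=
  parabolaPt_zero h

lemma stackPos_one {v : Fin (b + r * k + 2)} (h : v.1 ≤ b + r * k) :
    stackPos k b r v 1 = (v.1 : ℝ) ^ 2 :=
  parabolaPt_one h

lemma stackPos_apex_zero {v : Fin (b + r * k + 2)} (h : v.1 = b + r * k + 1) :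
    stackPos k b r v 0 = 0 := by
  rw [stackPos, h, parabolaPt_apex_zero]

lemma stackPos_apex_one {v : Fin (b + r * k + 2)} (h : v.1 = b + r * k + 1) :
    stackPos k b r v 1 = -(3 * (((b + r * k : ℕ) : ℝ) + 2) ^ 2) := by
  rw [stackPos, h, parabolaPt_apex_one]

/-- A criterion for the vertices of `s` to lie on a common big face: it suffices to separate them
from the hull edges and from the edges at the apex. -/
lemma exists_stack_face (hk : 4 ≤ k) (c : Plane) (s : Finset (Fin (b + r * k + 2)))
    (hs : s.Nonempty)
    (hhull : ∀ v ∈ s, ∀ i j : ℕ, i < j → j ≤ b + r * k → hullAdj k b r i j →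
      ∃ α β γ : ℝ, 0 < α * c 0 + β * c 1 + γ ∧
        0 ≤ α * stackPos k b r v 0 + β * stackPos k b r v 1 + γ ∧
        α * i + β * (i : ℝ) ^ 2 + γ ≤ 0 ∧ α * j + β * (j : ℝ) ^ 2 + γ ≤ 0)
    (hapex : ∀ v ∈ s, ∀ i : ℕ, i ≤ b + r * k → apexAdj k l a b r i →
      ∃ α β γ : ℝ, 0 < α * c 0 + β * c 1 + γ ∧
        0 ≤ α * stackPos k b r v 0 + β * stackPos k b r v 1 + γ ∧
        α * i + β * (i : ℝ) ^ 2 + γ ≤ 0 ∧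
        β * -(3 * (((b + r * k : ℕ) : ℝ) + 2) ^ 2) + γ ≤ 0) :
    ∃ F ∈ (stackPlaneGraph k l a b r hk).faces,
      s.card ≤ (stackPlaneGraph k l a b r hk).faceLength F ∧
      ∀ v ∈ s, stackPos k b r v ∈ frontier F := by
  refine PlaneGraph.exists_face_of_separated _ _ _ _ _ (stackGraph_mem_support hk) c s hs ?_
  intro v hv u u' huu'
  wlog hlt : u.1 < u'.1 generalizing u u'
  · have hne : u.1 ≠ u'.1 := fun h => huu'.ne (Fin.ext h)
    obtain ⟨α, β, γ, h1, h2, h3, h4⟩ := this u' u huu'.symm (by omega)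
    exact ⟨α, β, γ, h1, h2, h4, h3⟩
  rw [stackGraph_adj hk hlt] at huu'
  rcases huu' with h | ⟨hu', h⟩
  · obtain ⟨α, β, γ, h1, h2, h3, h4⟩ := hhull v hv u u' hlt h.le h
    have hle := h.le
    refine ⟨α, β, γ, h1, h2, ?_, ?_⟩
    · rwa [stackPos_zero (by omega), stackPos_one (by omega)]
    · rwa [stackPos_zero (by omega), stackPos_one (by omega)]
  · obtain ⟨α, β, γ, h1, h2, h3, h4⟩ := hapex v hv u h.1 h
    refine ⟨α, β, γ, h1, h2, ?_, ?_⟩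
    · rwa [stackPos_zero h.1, stackPos_one h.1]
    · rwa [stackPos_apex_zero hu', stackPos_apex_one hu', mul_zero, zero_add]

lemma card_filter_val_ge {n : ℕ} (t : Finset ℕ) (ht : ∀ i ∈ t, i < n) :
    t.card ≤ (Finset.univ.filter fun v : Fin n => v.1 ∈ t).card := by
  refine (Finset.card_le_card ?_).trans (Finset.card_image_le (f := Fin.val))
  intro i hi
  exact Finset.mem_image.2 ⟨⟨i, ht i hi⟩, by simpa using hi, rfl⟩

/-- If the apex has no neighbours strictly between `p` and `q`, then the apex and the points
`p, …, q` lie on a common face. -/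
lemma exists_gap_face (hk : 4 ≤ k) {p q : ℕ} (hpq : p < q) (hq : q ≤ b + r * k)
    (hgap : ∀ i, apexAdj k l a b r i → i ≤ p ∨ q ≤ i) :
    ∃ F ∈ (stackPlaneGraph k l a b r hk).faces,
      q - p + 2 ≤ (stackPlaneGraph k l a b r hk).faceLength F ∧
      ∀ v : Fin (b + r * k + 2), ((p ≤ v.1 ∧ v.1 ≤ q) ∨ v.1 = b + r * k + 1) →
        stackPos k b r v ∈ frontier F := by
  set t : Finset ℕ := insert (b + r * k + 1) (Finset.Icc p q) with ht
  have hcard : t.card = q - p + 2 := by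
    rw [ht, Finset.card_insert_of_notMem (by simp; omega), Nat.card_Icc]
    omega
  have hmem : ∀ i, i ∈ t ↔ i = b + r * k + 1 ∨ (p ≤ i ∧ i ≤ q) := by simp [ht]
  set m := b + r * k with hm
  set M : ℝ := 3 * (((b + r * k : ℕ) : ℝ) + 2) ^ 2 with hM
  have hp' : (p : ℝ) + 1 ≤ q := by exact_mod_cast hpq
  have hqm : (q : ℝ) ≤ m := by exact_mod_cast hq
  have hp0 : (0 : ℝ) ≤ p := Nat.cast_nonneg p
  have hpqM : 0 < ((q : ℝ) - p) * (M - p * q) := by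
    have := mul_lt_apex (m := m) (i := p) (j := q) (by omega) (by omega)
    have h2 := sq_nonneg ((m : ℝ) + 2)
    exact mul_pos (by linarith) (by rw [hM]; linarith)
  refine (exists_stack_face (l := l) (a := a) hk
    !₂[((p : ℝ) + q) / 4, (-2 * M + (p : ℝ) ^ 2 + (q : ℝ) ^ 2) / 4]
    (Finset.univ.filter fun v : Fin (b + r * k + 2) => v.1 ∈ t) ?_ ?_ ?_).imp
      fun F hF => ⟨hF.1, ?_, fun v hv => hF.2.2 v ?_⟩
  rotate_right 2
  · rw [← hcard]
    refine (card_filter_val_ge t fun i hi => ?_).trans hF.2.1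
    rw [hmem] at hi
    omega
  · rw [Finset.mem_filter, hmem]
    exact ⟨Finset.mem_univ _, hv.symm⟩
  · exact ⟨⟨b + r * k + 1, Nat.lt_succ_self _⟩,
      Finset.mem_filter.2 ⟨Finset.mem_univ _, (hmem _).2 (Or.inl rfl)⟩⟩
  · -- the line through `x` and `x + 1` supports the hull
    intro v hv i j hij hj h
    rw [Finset.mem_filter, hmem] at hv
    obtain ⟨x, hxp, hxq, hxv⟩ : ∃ x, p ≤ x ∧ x < q ∧ (v.1 = m + 1 ∨ v.1 = x ∨ v.1 = x + 1) := by
      rcases hv.2 with h | h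
      · exact ⟨p, le_rfl, hpq, Or.inl h⟩
      · rcases Nat.lt_or_ge v.1 q with h' | h'
        · exact ⟨v.1, h.1, h', Or.inr (Or.inl rfl)⟩
        · exact ⟨q - 1, by omega, by omega, Or.inr (Or.inr (by omega))⟩
    have hx1 : (x : ℝ) + 1 ≤ m := by exact_mod_cast (show x + 1 ≤ m by omega)
    have hx0 : (0 : ℝ) ≤ x := Nat.cast_nonneg x
    have hxM : (x : ℝ) * (x + 1) ≤ (m : ℝ) ^ 2 := by nlinarith
    have hpM : (p : ℝ) ^ 2 ≤ (m : ℝ) ^ 2 := by nlinarith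
    have hqM : (q : ℝ) ^ 2 ≤ (m : ℝ) ^ 2 := by nlinarith
    refine ⟨2 * x + 1, -1, -(x * (x + 1)), ?_, ?_, ?_, ?_⟩
    · simp only [Matrix.cons_val_zero, Matrix.cons_val_one]
      have : 0 ≤ (2 * (x : ℝ) + 1) * (p + q) := by positivity
      have hm0 : (0 : ℝ) ≤ m := Nat.cast_nonneg m
      have hMm : M = 3 * ((m : ℝ) + 2) ^ 2 := hM
      rw [hMm]
      nlinarith
    · rcases hxv with hxv | hxv | hxv
      · rw [stackPos_apex_zero hxv, stackPos_apex_one hxv]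
        have hMm : M = 3 * ((m : ℝ) + 2) ^ 2 := hM
        have hm0 : (0 : ℝ) ≤ m := Nat.cast_nonneg m
        rw [← hM, hMm]
        nlinarith
      · rw [stackPos_zero (by omega), stackPos_one (by omega), hxv]
        linarith
      · rw [stackPos_zero (by omega), stackPos_one (by omega), hxv]
        push_cast
        linarith
    · linarith [mul_pred_nonneg i x]
    · linarith [mul_pred_nonneg j x]
  · -- the lines through the apex and `p`, `q` bound the gap
    intro v hv i hi h
    rw [Finset.mem_filter, hmem] at hv
    rcases hgap i h with h | h
    · refine ⟨(p : ℝ) ^ 2 + M, -p, -p * M, ?_, ?_, ?_, ?_⟩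
      · simp only [Matrix.cons_val_zero, Matrix.cons_val_one]
        linarith
      · rcases hv.2 with hv | hv
        · rw [stackPos_apex_zero hv, stackPos_apex_one hv, ← hM]
          linarith
        · rw [stackPos_zero (by omega), stackPos_one (by omega)]
          have := (mul_apex_sub_nonneg (m := m) (j := p) hv.1 (by omega) (by omega)).1
          rw [← hM] at this
          linarith
      · have := (mul_apex_sub_nonneg (m := m) (j := p) h (by omega) (by omega)).2
        rw [← hM] at this
        linarith
      · linarith
    · refine ⟨-((q : ℝ) ^ 2 + M), q, q * M, ?_, ?_, ?_, ?_⟩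
      · simp only [Matrix.cons_val_zero, Matrix.cons_val_one]
        linarith
      · rcases hv.2 with hv | hv
        · rw [stackPos_apex_zero hv, stackPos_apex_one hv, ← hM]
          linarith
        · rw [stackPos_zero (by omega), stackPos_one (by omega)]
          have := (mul_apex_sub_nonneg (m := m) (j := q) hv.2 (by omega) (by omega)).2
          rw [← hM] at this
          linarith
      · have := (mul_apex_sub_nonneg (m := m) (j := q) h (by omega) (by omega)).1
        rw [← hM] at this
        linarith
      · linarith

/-- The vertices of a block lie on a common face. -/
lemma exists_block_face (hk : 4 ≤ k) {g : ℕ} (hg : g < r) :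
    ∃ F ∈ (stackPlaneGraph k l a b r hk).faces,
      k ≤ (stackPlaneGraph k l a b r hk).faceLength F ∧
      ∀ v : Fin (b + r * k + 2), b + 1 + g * k ≤ v.1 → v.1 ≤ b + g * k + k →
        stackPos k b r v ∈ frontier F := by
  have hgr := block_le (k := k) hg
  have hout := fun i j => hullAdj.outside_or_path (k := k) (b := b) (r := r) (i := i) (j := j) hg
  obtain ⟨p, hp⟩ : ∃ p, p = b + 1 + g * k := ⟨_, rfl⟩
  obtain ⟨q, hq⟩ : ∃ q, q = b + g * k + k := ⟨_, rfl⟩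
  rw [← hp, ← hq] at hout ⊢
  have hqk : q + 1 = p + k := by omega
  have hqm : q ≤ b + r * k := by omega
  have hcard : (Finset.Icc p q).card = k := by
    rw [Nat.card_Icc]
    omega
  set m := b + r * k with hm
  set M : ℝ := 3 * (((b + r * k : ℕ) : ℝ) + 2) ^ 2 with hM
  have hpq : (p : ℝ) + 3 ≤ q := by exact_mod_cast (show p + 3 ≤ q by omega)
  -- the supporting line through `x` and `x + 1` does not pass through the centre of the block
  have hsupp : ∀ x : ℕ, p ≤ x → x < q →
      0 < ((p : ℝ) - x) * (p - x - 1) + ((p : ℝ) + 1 - x) * (p - x) + (q - x) * (q - x - 1) := by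
    intro x h1 h2
    have e2 := mul_pred_nonneg (p + 1) x
    push_cast at e2
    have e3 := mul_pred_nonneg q x
    rcases Nat.lt_or_ge p x with h | h
    · have : (p : ℝ) + 1 ≤ x := by exact_mod_cast h
      nlinarith
    · obtain rfl : x = p := by omega
      nlinarith
  refine (exists_stack_face (l := l) (a := a) hk
    !₂[((p : ℝ) + (p + 1) + q) / 3, ((p : ℝ) ^ 2 + ((p : ℝ) + 1) ^ 2 + (q : ℝ) ^ 2) / 3]
    (Finset.univ.filter fun v : Fin (b + r * k + 2) => v.1 ∈ Finset.Icc p q) ?_ ?_ ?_).imp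
      fun F hF => ⟨hF.1, ?_, fun v hv hv' => hF.2.2 v ?_⟩
  rotate_right 2
  · conv_lhs => rw [← hcard]
    refine (card_filter_val_ge _ fun i hi => ?_).trans hF.2.1
    rw [Finset.mem_Icc] at hi
    omega
  · rw [Finset.mem_filter, Finset.mem_Icc]
    exact ⟨Finset.mem_univ _, hv, hv'⟩
  · exact ⟨⟨p, by omega⟩, by simp; omega⟩
  · intro v hv i j hij hj h
    rw [Finset.mem_filter, Finset.mem_Icc] at hv
    rw [stackPos_zero (by omega), stackPos_one (by omega)]
    rcases hout i j h with h | h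
    · -- the chord of the block
      have hside : ∀ w : ℕ, (w ≤ p ∨ q ≤ w) → ((w : ℝ) - p) * (q - w) ≤ 0 := by
        rintro w (hw | hw)
        · have : (w : ℝ) ≤ p := by exact_mod_cast hw
          nlinarith
        · have : (q : ℝ) ≤ w := by exact_mod_cast hw
          nlinarith
      refine ⟨p + q, -1, -p * q, ?_, ?_, ?_, ?_⟩
      · simp only [Matrix.cons_val_zero, Matrix.cons_val_one]
        nlinarith
      · have h1 : (p : ℝ) ≤ v.1 := by exact_mod_cast hv.2.1
        have h2 : (v.1 : ℝ) ≤ q := by exact_mod_cast hv.2.2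
        nlinarith [mul_nonneg (sub_nonneg.2 h1) (sub_nonneg.2 h2)]
      · linarith [hside i h.1]
      · linarith [hside j h.2]
    · obtain ⟨rfl, h1, h2⟩ := h
      refine ⟨-(2 * i + 1), 1, i * (i + 1), ?_, ?_, ?_, ?_⟩
      · simp only [Matrix.cons_val_zero, Matrix.cons_val_one]
        linarith [hsupp i h1 (by omega)]
      · linarith [mul_pred_nonneg v.1 i]
      · linarith
      · push_cast
        linarith
  · intro v hv i hi h
    rw [Finset.mem_filter, Finset.mem_Icc] at hv
    rw [stackPos_zero (by omega), stackPos_one (by omega), ← hM]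
    have hpM := mul_lt_apex (m := m) (i := p) (j := q) (by omega) (by omega)
    have hp1M := mul_lt_apex (m := m) (i := p) (j := p + 1) (by omega) (by omega)
    have hq1M := mul_lt_apex (m := m) (i := q) (j := p + 1) (by omega) (by omega)
    have hMm : M = 3 * ((m : ℝ) + 2) ^ 2 := hM
    have hsq := sq_nonneg ((m : ℝ) + 2)
    push_cast at hp1M hq1M
    rcases (by omega : i < p ∨ q < i ∨ (p ≤ i ∧ i ≤ q)) with h | h | h
    · refine ⟨(p : ℝ) ^ 2 + M, -p, -p * M, ?_, ?_, ?_, ?_⟩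
      · simp only [Matrix.cons_val_zero, Matrix.cons_val_one]
        have e1 : 0 < ((q : ℝ) - p) * (M - p * q) := mul_pos (by linarith) (by linarith)
        have e2 : 0 < M - p * (p + 1) := by linarith
        linarith
      · have := (mul_apex_sub_nonneg (m := m) (j := p) hv.2.1 (by omega) (by omega)).1
        rw [← hMm] at this
        linarith
      · have := (mul_apex_sub_nonneg (m := m) (j := p) h.le (by omega) (by omega)).2
        rw [← hMm] at this
        linarith
      · linarith
    · refine ⟨-((q : ℝ) ^ 2 + M), q, q * M, ?_, ?_, ?_, ?_⟩
      · simp only [Matrix.cons_val_zero, Matrix.cons_val_one]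
        have e1 : 0 < ((q : ℝ) - p) * (M - p * q) := mul_pos (by linarith) (by linarith)
        have e2 : 0 < ((q : ℝ) - (p + 1)) * (M - q * (p + 1)) :=
          mul_pos (by linarith) (by linarith)
        linarith
      · have := (mul_apex_sub_nonneg (m := m) (j := q) hv.2.2 (by omega) (by omega)).2
        rw [← hMm] at this
        linarith
      · have := (mul_apex_sub_nonneg (m := m) (j := q) h.le (by omega) (by omega)).1
        rw [← hMm] at this
        linarith
      · linarith
    · obtain ⟨x, hxp, hxq, hxi⟩ : ∃ x, p ≤ x ∧ x < q ∧ (i = x ∨ i = x + 1) := by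
        rcases Nat.lt_or_ge i q with h' | h'
        · exact ⟨i, h.1, h', Or.inl rfl⟩
        · exact ⟨q - 1, by omega, by omega, Or.inr (by omega)⟩
      have hxM := mul_lt_apex (m := m) (i := x) (j := x + 1) (by omega) (by omega)
      push_cast at hxM
      refine ⟨-(2 * x + 1), 1, x * (x + 1), ?_, ?_, ?_, ?_⟩
      · simp only [Matrix.cons_val_zero, Matrix.cons_val_one]
        linarith [hsupp x hxp hxq]
      · linarith [mul_pred_nonneg v.1 x]
      · rcases hxi with rfl | rfl
        · linarith
        · push_cast
          linarith
      · linarith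

/-- Every vertex of the extremal graph is on a face of length at least `k`. -/
lemma stackPlaneGraph_everyVertexBoundsGon (hk : 4 ≤ k) (hl : k ≤ l + 2) (hla : l ≤ a)
    (hal : a ≤ l + 1) (hb : (a = l ∧ b = a) ∨ b + 2 = a + k) :
    (stackPlaneGraph k l a b r hk).EveryVertexBoundsGon k := by
  intro v
  change ∃ F ∈ (stackPlaneGraph k l a b r hk).faces,
    k ≤ (stackPlaneGraph k l a b r hk).faceLength F ∧ stackPos k b r v ∈ frontier F
  by_cases h1 : v.1 ≤ l ∨ v.1 = b + r * k + 1
  · obtain ⟨F, hF, hlen, hfr⟩ := exists_gap_face (l := l) (a := a) (b := b) (r := r) hk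
      (p := 0) (q := l) (by omega) (by omega) (fun i hi => by have := hi.2.1; omega)
    exact ⟨F, hF, by omega, hfr v (by omega)⟩
  by_cases h2 : v.1 ≤ b
  · obtain ⟨F, hF, hlen, hfr⟩ := exists_gap_face (l := l) (a := a) (b := b) (r := r) hk
      (p := a) (q := b) (by omega) (by omega) (fun i hi => by have := hi.2.2; omega)
    exact ⟨F, hF, by omega, hfr v (by omega)⟩
  · have hv := v.2
    have hdiv := Nat.div_add_mod (v.1 - (b + 1)) k
    have hmod := Nat.mod_lt (v.1 - (b + 1)) (show 0 < k by omega)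
    rw [mul_comm] at hdiv
    have hg : (v.1 - (b + 1)) / k < r := by
      rw [Nat.div_lt_iff_lt_mul (by omega)]
      omega
    obtain ⟨F, hF, hlen, hfr⟩ := exists_block_face (l := l) (a := a) (b := b) hk hg
    exact ⟨F, hF, hlen, hfr v (by omega) (by omega)⟩

end BigFaces

/-! ### The number of edges of the extremal graphs -/

lemma card_le_numEdges_stack {k l a b r : ℕ} (hk : 4 ≤ k) (S : Finset (ℕ × ℕ))
    (hS : ∀ p ∈ S, hullAdj k b r p.1 p.2 ∨ (p.2 = b + r * k + 1 ∧ apexAdj k l a b r p.1)) :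
    S.card ≤ (stackPlaneGraph k l a b r hk).numEdges := by
  classical
  have hlt : ∀ p ∈ S, p.1 < p.2 ∧ p.2 < b + r * k + 2 := by
    intro p hp
    rcases hS p hp with h | ⟨h, h'⟩
    · have := h.lt hk
      have := h.le
      omega
    · have := h'.1
      omega
  have hval : ∀ i, i < b + r * k + 2 → (Fin.ofNat (b + r * k + 2) i).1 = i := fun i hi => by
    rw [Fin.val_ofNat, Nat.mod_eq_of_lt hi]
  rw [PlaneGraph.numEdges, Set.ncard_eq_toFinset_card']
  refine Finset.card_le_card_of_injOn
    (fun p => s(Fin.ofNat (b + r * k + 2) p.1, Fin.ofNat (b + r * k + 2) p.2)) ?_ ?_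
  · intro p hp
    obtain ⟨h1, h2⟩ := hlt p hp
    rw [Finset.mem_coe, Set.mem_toFinset]
    change (stackGraph k l a b r).Adj _ _
    rw [stackGraph_adj hk (by rw [hval _ (by omega), hval _ h2]; exact h1), hval _ (by omega),
      hval _ h2]
    exact hS p hp
  · intro p hp p' hp' h
    obtain ⟨h1, h2⟩ := hlt p hp
    obtain ⟨h1', h2'⟩ := hlt p' hp'
    rcases Sym2.eq_iff.1 h with ⟨e1, e2⟩ | ⟨e1, e2⟩
    · have e1 := congrArg Fin.val e1
      have e2 := congrArg Fin.val e2
      rw [hval _ (by omega), hval _ (by omega)] at e1 e2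
      exact Prod.ext e1 e2
    · have e1 := congrArg Fin.val e1
      have e2 := congrArg Fin.val e2
      rw [hval _ (by omega), hval _ (by omega)] at e1 e2
      omega

/-- The edges are those of the path and of the chords, and those from `0` and from the apex which
do not lead into the interior of a block or of a gap. -/
lemma le_numEdges_stack {k l a b r : ℕ} (hk : 4 ≤ k) (hb : 2 ≤ b) :
    (b + r * k) + ((b + r * k + 1) - (l - 1) - (b - a - 1)) + ((b + r * k - 1) - r * (k - 2)) + r
      ≤ (stackPlaneGraph k l a b r hk).numEdges := by
  classical
  set m := b + r * k with hm
  set path : Finset (ℕ × ℕ) := (Finset.range m).image fun i => (i, i + 1) with hpath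
  set apex : Finset (ℕ × ℕ) :=
    (Finset.range (m + 1) \ (Finset.Ioo 0 l ∪ Finset.Ioo a b)).image fun i => (i, m + 1) with hapex
  set fan : Finset (ℕ × ℕ) := (Finset.Icc 2 m \ (Finset.range r).biUnion fun g =>
    Finset.Ioo (b + 1 + g * k) (b + g * k + k)).image fun j => (0, j) with hfan
  set chords : Finset (ℕ × ℕ) :=
    (Finset.range r).image fun g => (b + 1 + g * k, b + g * k + k) with hchords
  have c1 : path.card = m := by
    rw [hpath, Finset.card_image_of_injective _ (fun i j h => (Prod.ext_iff.1 h).1),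
      Finset.card_range]
  have c2 : m + 1 - (l - 1) - (b - a - 1) ≤ apex.card := by
    rw [hapex, Finset.card_image_of_injective _ (fun i j h => (Prod.ext_iff.1 h).1)]
    have h1 := Finset.le_card_sdiff (Finset.Ioo 0 l ∪ Finset.Ioo a b) (Finset.range (m + 1))
    have h2 := Finset.card_union_le (Finset.Ioo 0 l) (Finset.Ioo a b)
    rw [Finset.card_range] at h1
    rw [Nat.card_Ioo, Nat.card_Ioo] at h2
    omega
  have c3 : m - 1 - r * (k - 2) ≤ fan.card := by
    rw [hfan, Finset.card_image_of_injective _ (fun i j h => (Prod.ext_iff.1 h).2)]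
    refine le_trans ?_ (Finset.le_card_sdiff _ _)
    have h2 : ((Finset.range r).biUnion fun g =>
        Finset.Ioo (b + 1 + g * k) (b + g * k + k)).card ≤ r * (k - 2) := by
      refine (Finset.card_biUnion_le_card_mul _ _ (k - 2) fun g _ => ?_).trans (by simp)
      rw [Nat.card_Ioo]
      omega
    rw [Nat.card_Icc]
    omega
  have c4 : chords.card = r := by
    rw [hchords, Finset.card_image_of_injective _ (fun i j h => ?_), Finset.card_range]
    have := (Prod.ext_iff.1 h).1
    exact Nat.eq_of_mul_eq_mul_right (show 0 < k by omega) (by simpa using this)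
  have d1 : Disjoint path apex := by
    rw [Finset.disjoint_left]
    rintro p h1 h2
    simp only [hpath, hapex, Finset.mem_image, Finset.mem_range, Prod.ext_iff] at h1 h2
    obtain ⟨i, hi, h1⟩ := h1
    obtain ⟨j, hj, h2⟩ := h2
    omega
  have d2 : Disjoint (path ∪ apex) fan := by
    rw [Finset.disjoint_left]
    rintro p h1 h2
    simp only [hpath, hapex, hfan, Finset.mem_union, Finset.mem_image, Finset.mem_range,
      Finset.mem_sdiff, Finset.mem_Icc, Prod.ext_iff] at h1 h2
    obtain ⟨j, hj, h2⟩ := h2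
    rcases h1 with ⟨i, hi, h1⟩ | ⟨i, hi, h1⟩ <;> omega
  have d3 : Disjoint (path ∪ apex ∪ fan) chords := by
    rw [Finset.disjoint_left]
    rintro p h1 h2
    simp only [hpath, hapex, hfan, hchords, Finset.mem_union, Finset.mem_image, Finset.mem_range,
      Finset.mem_sdiff, Finset.mem_Icc, Prod.ext_iff] at h1 h2
    obtain ⟨g, hg, h2⟩ := h2
    have := block_le (k := k) hg
    rcases h1 with (⟨i, hi, h1⟩ | ⟨i, hi, h1⟩) | ⟨i, hi, h1⟩ <;> omega
  have hle := card_le_numEdges_stack (l := l) (a := a) (b := b) (r := r) hk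
    (path ∪ apex ∪ fan ∪ chords) ?_
  · rw [Finset.card_union_of_disjoint d3, Finset.card_union_of_disjoint d2,
      Finset.card_union_of_disjoint d1] at hle
    omega
  · intro p hp
    simp only [hpath, hapex, hfan, hchords, Finset.mem_union, Finset.mem_image, Finset.mem_range,
      Finset.mem_sdiff, Finset.mem_Icc, Finset.mem_Ioo, Finset.mem_biUnion] at hp
    rcases hp with ((⟨i, hi, rfl⟩ | ⟨i, hi, rfl⟩) | ⟨j, hj, rfl⟩) | ⟨g, hg, rfl⟩
    · exact Or.inl (Or.inl ⟨rfl, by omega⟩)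
    · exact Or.inr ⟨rfl, by omega, by omega, by omega⟩
    · exact Or.inl (Or.inr (Or.inl ⟨rfl, by omega, by omega, fun g hg h => hj.2 ⟨g, hg, h⟩⟩))
    · exact Or.inl (Or.inr (Or.inr ⟨g, hg, rfl, rfl⟩))

/-- With `n = q k + β`: if `β ≤ k - 3` there is one gap of length `k + β` besides `q - 1` blocks, and
otherwise there are two gaps of length `k`, sharing the apex and, if `β = k - 2`, one more vertex,
besides `q - 1` blocks. -/
lemma exists_numEdges_ge {k n : ℕ} (hk : 4 ≤ k) (hn : k ≤ n) :
    ∃ G : PlaneGraph (Fin n), G.EveryVertexBoundsGon k ∧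
      2 * n - 6 + 3 * (n / k : ℕ) + max 0 ((n % k : ℕ) + 3 - k : ℤ) ≤ (G.numEdges : ℤ) := by
  have hdiv := Nat.div_add_mod n k
  have hmod := Nat.mod_lt n (show 0 < k by omega)
  obtain ⟨r, hr⟩ : ∃ r, n / k = r + 1 :=
    ⟨n / k - 1, by have := (Nat.one_le_div_iff (show 0 < k by omega)).2 hn; omega⟩
  rw [hr] at hdiv ⊢
  set β := n % k with hβ
  rw [mul_comm, Nat.succ_mul] at hdiv
  have hrk : r * (k - 2) + 2 * r = r * k := by
    rw [mul_comm 2 r, ← mul_add]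
    congr 1
    omega
  obtain ⟨l, a, b, hl, hla, hal, hb, hnb, hcount⟩ : ∃ l a b : ℕ, k ≤ l + 2 ∧ l ≤ a ∧ a ≤ l + 1 ∧
      ((a = l ∧ b = a) ∨ b + 2 = a + k) ∧ n = b + r * k + 2 ∧
      (2 * n - 6 + 3 * (r + 1 : ℕ) + max 0 (β + 3 - k : ℤ) ≤
        (((b + r * k) + ((b + r * k + 1) - (l - 1) - (b - a - 1))
          + ((b + r * k - 1) - r * (k - 2)) + r : ℕ) : ℤ)) := by
    rcases (by omega : β + 3 ≤ k ∨ β + 2 = k ∨ β + 1 = k) with h | h | h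
    · refine ⟨k + β - 2, k + β - 2, k + β - 2, by omega, by omega, by omega, by omega, by omega, ?_⟩
      rw [max_eq_left (by omega)]
      omega
    · refine ⟨k - 2, k - 2, 2 * k - 4, by omega, by omega, by omega, by omega, by omega, ?_⟩
      rw [max_eq_right (by omega)]
      omega
    · refine ⟨k - 2, k - 1, 2 * k - 3, by omega, by omega, by omega, by omega, by omega, ?_⟩
      rw [max_eq_right (by omega)]
      omega
  subst hnb
  refine ⟨stackPlaneGraph k l a b r hk, stackPlaneGraph_everyVertexBoundsGon hk hl hla hal hb,
    hcount.trans ?_⟩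
  exact_mod_cast le_numEdges_stack hk (by omega)

theorem theorem1 (k n : ℕ) (hk : 4 ≤ k) (hn : k ≤ n) :
    IsGreatest
      {m : ℤ | ∃ G : PlaneGraph (Fin n), G.EveryVertexBoundsGon k ∧ (G.numEdges : ℤ) = m}
      (⌊((2 * (k : ℝ) + 3) * (n : ℝ)) / (k : ℝ) - 6⌋ - alphaCorrection k n) := by
  rw [floor_sub_alphaCorrection hk]
  constructor
  · obtain ⟨G, hG, hle⟩ := exists_numEdges_ge hk hn
    exact ⟨G, hG, le_antisymm (G.numEdges_le hk hn (Fintype.card_fin n) hG) hle⟩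
  · rintro _ ⟨G, hG, rfl⟩
    exact G.numEdges_le hk hn (Fintype.card_fin n) hG
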